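/- Let $L:\mathbb R^p\to\mathbb R\cup\{+\infty\}$ be a proper, closed, convex function with open effective domain $D\ni 0$, twice differentiable on $D$, with $\nabla L(0)\neq 0$. Assume that for some constants $\beta>0$, $0\le\gamma_1<2$, $0\le\gamma_2<2$, $$\|\nabla L(\theta+\delta)-\nabla L(\theta)-\nabla^2L(\theta)\delta\|_2\le\beta\,\delta^\top[\nabla^2L(\theta)]^{\gamma_1}\delta$$ whenever $\theta,\theta+\delta\in D$ and $\delta^\top[\nabla^2L(\theta)]^{\gamma_2}\delta\le\beta^{-2}$. For $t\in[0,\infty]$ put $f_t(\theta)=(1-e^{-t})L(\theta)+\frac{e^{-t}}2\|\theta\|_2^2$ (so $f_\infty=L$), let $\theta(t)$ be the minimizer of $f_t$ for $t<\infty$, and let $\theta(\infty)$ be the minimizer of $L$ of least Euclidean norm. Let $t_{\max}\in(0,\infty]$ and suppose that $\|\theta(t_{\max})\|_2<\infty$ (that is, if $t_{\max}=\infty$, that $L$ has a minimizer) and that $\gamma_1\ge1$. Fix $0<\alpha_{\max}\le 1/10$ and $c\in(0,1]$. Let $C_2=442$, let $\nu$ be the largest eigenvalue of $\nabla^2L(0)$,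 and let $C_1=15$ if $\gamma_1\le1$ and $C_1=15\min(\nu^{\gamma_1-1},\nu^{\gamma_1}e^{-\alpha_1}(1-e^{-\alpha_1}))$ if $\gamma_1>1$. For $\epsilon>0$ choose the first step size $\alpha_1$ with $cM\le\alpha_1\le M$, where $$M=\min\Big\{\alpha_{\max},\ \ln\Big(1+\tfrac{\sqrt\epsilon}{\|\nabla L(0)\|_2}\Big),\ \ln\Big(1+\big(\max(C_1,\sqrt2C_2)\,\beta\|\nabla L(0)\|_2\big)^{-1/\min(2-\gamma_1,\,1-\gamma_2/2)}\Big)\Big\}$$ (when $\gamma_1>1$, $C_1$ and hence $M$ depend on $\alpha_1$). Starting from $t_0=0$, $\theta_0=0$, let $t_{k+1}=t_k+\alpha_{k+1}$, let $$\theta_{k+1}=\theta_k-\big((1-e^{-t_{k+1}})\nabla^2L(\theta_k)+e^{-t_{k+1}}I\big)^{-1}\big((1-e^{-t_{k+1}})\nabla L(\theta_k)+e^{-t_{k+1}}\theta_k\big)$$ (one Newton step per grid point), and for $k\ge1$ let $$\alpha_{k+1}=\min\Big\{\alpha_{\max},\,2\alpha_k,\,\ln\Big(1+\tfrac{e^{t_k/2}(e^{\alpha_1}-1)\|\nabla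 L(0)\|_2(1-e^{-t_k})}{\|\theta_k\|_2}\Big),\,\ln\Big(1+\big(C_2\beta e^{t_k}\max\{(e^{t_k}-1)^{-\gamma_1},(e^{t_k}-1)^{-1-\gamma_2/2}\}\|\theta_k\|_2\big)^{-1}\Big)\Big\}.$$ Stop at the first $N\ge1$ with $t_N>t_{\max}$ or $\frac{2\|\theta_N\|_2^2}{e^{t_N}-1}\le(e^{\alpha_1}-1)^2\|\nabla L(0)\|_2^2$. Let $\tilde\theta$ be the piecewise linear interpolation of $\theta_0,\dots,\theta_N$ at $t_0,\dots,t_N$, continued by the constant $\theta_N$ after $t_N$. Then there are constants $K,K'$, independent of $\epsilon$ and of the choice of $\alpha_1$ (they may depend on $L$, $\beta$, $\gamma_1$, $\gamma_2$, $t_{\max}$, $\alpha_{\max}$ and $c$), such that for every $\epsilon>0$ and every such $\alpha_1$ the algorithm stops after a finite number $N$ of Newton steps, $$N\le K\max(1,\epsilon^{-1/2}),$$ and $\tilde\theta(t)\in D$ and $f_t(\tilde\theta(t))-f_t(\theta(t))\le K'\epsilon$ for all $0\le t\le t_{\max}$. In particular, $N=\mathcal O(\epsilon^{-1/2})$ as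 $\epsilon\to0$, also when $t_{\max}=\infty$. -/

import Mathlib

open Set
open scoped ENNReal

noncomputable section

namespace NewtonPath

/-- The parameter space `ℝ^p` with the Euclidean norm. -/
abbrev Param (p : ℕ) : Type := EuclideanSpace ℝ (Fin p)

/-- The Hessian of `L` at `x`, as a linear operator: the derivative of the gradient. -/
def hess {p : ℕ} (L : Param p → ℝ) (x : Param p) : Param p →L[ℝ] Param p :=
  fderiv ℝ (gradient L) x

/-- The real power `A ^ γ` of a positive semidefinite operator (the eigenvalues are raised to the
power `γ`, with `0 ^ 0 = 1`, so that `A ^ 0` is the identity), by the functional calculus of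
matrices. -/
def opPow {p : ℕ} (A : Param p →L[ℝ] Param p) (γ : ℝ) : Param p →L[ℝ] Param p :=
  Matrix.toEuclideanCLM (n := Fin p) (𝕜 := ℝ)
    (cfc (fun x : ℝ => x ^ γ) ((Matrix.toEuclideanCLM (n := Fin p) (𝕜 := ℝ)).symm A))

/-- The extended-valued loss that equals `L` on its effective domain `D` and `+∞` elsewhere is
proper, closed (closed epigraph) and convex, it is twice differentiable on `D` (which is open),
and it satisfies the local Lipschitz Hessian condition with constants `β`, `γ₁`, `γ₂`. -/
structure LocalLipschitzHessian {p : ℕ} (L : Param p → ℝ) (D : Set (Param p))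
    (β γ₁ γ₂ : ℝ) : Prop where
  isOpen_dom : IsOpen D
  proper : D.Nonempty
  convex : ConvexOn ℝ D L
  closed : IsClosed {q : Param p × ℝ | q.1 ∈ D ∧ L q.1 ≤ q.2}
  differentiable : ∀ x ∈ D, DifferentiableAt ℝ L x
  twice_differentiable : ∀ x ∈ D, DifferentiableAt ℝ (gradient L) x
  beta_pos : 0 < β
  gamma_one_mem : γ₁ ∈ Ico (0 : ℝ) 2
  gamma_two_mem : γ₂ ∈ Ico (0 : ℝ) 2
  local_lipschitz : ∀ x ∈ D, ∀ δ : Param p, x + δ ∈ D →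
    inner ℝ δ (opPow (hess L x) γ₂ δ) ≤ (β ^ 2)⁻¹ →
    ‖gradient L (x + δ) - gradient L x - hess L x δ‖ ≤
      β * inner ℝ δ (opPow (hess L x) γ₁ δ)

/-- `e^{-t}` for `t ∈ [0, ∞]`, with `e^{-∞} = 0`. -/
def expNeg (t : ℝ≥0∞) : ℝ := if t = ⊤ then 0 else Real.exp (-t.toReal)

/-- The scaled objective `f_t(θ) = (1 - e^{-t}) L(θ) + (e^{-t} / 2) ‖θ‖²`; `f_∞ = L`. -/
def objective {p : ℕ} (L : Param p → ℝ) (t : ℝ≥0∞) (θ : Param p) : ℝ :=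
  (1 - expNeg t) * L θ + expNeg t / 2 * ‖θ‖ ^ 2

/-- `ϑ = θ(t)`: the minimizer of `f_t` on `D`, and, when `t = ∞`, the minimizer of `L` of least
norm. (For `t < ∞` the minimizer is unique, so the last clause only matters for `t = ∞`.) -/
def IsSolution {p : ℕ} (L : Param p → ℝ) (D : Set (Param p)) (t : ℝ≥0∞) (ϑ : Param p) : Prop :=
  ϑ ∈ D ∧ IsMinOn (objective L t) D ϑ ∧
    ∀ y ∈ D, IsMinOn (objective L t) D y → ‖ϑ‖ ≤ ‖y‖

/-- One Newton step for `f_t` started from `x`. -/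
def newtonUpdate {p : ℕ} (L : Param p → ℝ) (t : ℝ) (x : Param p) : Param p :=
  x - ((1 - Real.exp (-t)) • hess L x
        + Real.exp (-t) • ContinuousLinearMap.id ℝ (Param p)).inverse
      ((1 - Real.exp (-t)) • gradient L x + Real.exp (-t) • x)

/-- The constant `C₁`, which depends on the first step size `α₁` when `γ₁ > 1`; here
`sSup (spectrum ℝ _)` is the largest eigenvalue of the Hessian at `0`. -/
def constC₁ {p : ℕ} (L : Param p → ℝ) (γ₁ α₁ : ℝ) : ℝ :=
  if γ₁ ≤ 1 then 15
  else 15 * min (sSup (spectrum ℝ (hess L 0)) ^ (γ₁ - 1))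
    (sSup (spectrum ℝ (hess L 0)) ^ γ₁ * (Real.exp (-α₁) * (1 - Real.exp (-α₁))))

/-- The constant `C₂`. -/
def constC₂ : ℝ := 442

/-- The upper bound required of the first step size `α₁`. -/
def firstStepBound {p : ℕ} (L : Param p → ℝ) (β γ₁ γ₂ αmax ε α₁ : ℝ) : ℝ :=
  min αmax
    (min (Real.log (1 + Real.sqrt ε / ‖gradient L 0‖))
      (Real.log (1 + (max (constC₁ L γ₁ α₁) (Real.sqrt 2 * constC₂) * β * ‖gradient L 0‖)
        ^ (-(1 / min (2 - γ₁) (1 - γ₂ / 2))))))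

/-- The step size `α_{k+1}`, `k ≥ 1`, computed from `α_k = α`, `t_k = t`, `θ_k = θ`. -/
def nextStep {p : ℕ} (L : Param p → ℝ) (β γ₁ γ₂ αmax α₁ α t : ℝ) (θ : Param p) : ℝ :=
  min (min αmax (2 * α))
    (min
      (Real.log (1 + Real.exp (t / 2) * (Real.exp α₁ - 1) * ‖gradient L 0‖
        * (1 - Real.exp (-t)) / ‖θ‖))
      (Real.log (1 + (constC₂ * β * Real.exp t
        * max ((Real.exp t - 1) ^ (-γ₁)) ((Real.exp t - 1) ^ (-1 - γ₂ / 2)) * ‖θ‖)⁻¹)))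

/-- The state of the algorithm after `k` Newton steps: `α_k`, `t_k` and `θ_k`. -/
structure State (p : ℕ) where
  stepSize : ℝ
  time : ℝ
  iterate : Param p

/-- The path-following Newton algorithm, one Newton step per grid point, started from `t₀ = 0`
and `θ₀ = 0` (there is no `α₀`; the entry is a placeholder that is never used). -/
def run {p : ℕ} (L : Param p → ℝ) (β γ₁ γ₂ αmax α₁ : ℝ) : ℕ → State p
  | 0 => ⟨0, 0, 0⟩
  | k + 1 =>
    let s := run L β γ₁ γ₂ αmax α₁ k
    let α := if k = 0 then α₁ else nextStep L β γ₁ γ₂ αmax α₁ s.stepSize s.time s.iterate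
    ⟨α, s.time + α, newtonUpdate L (s.time + α) s.iterate⟩

/-- The termination criterion, tested in the state reached after a Newton step. -/
def Terminates {p : ℕ} (L : Param p → ℝ) (tmax : ℝ≥0∞) (α₁ : ℝ) (s : State p) : Prop :=
  tmax < ENNReal.ofReal s.time ∨
    2 * ‖s.iterate‖ ^ 2 / (Real.exp s.time - 1) ≤ (Real.exp α₁ - 1) ^ 2 * ‖gradient L 0‖ ^ 2

/-- The approximate path at time `t`: the piecewise linear interpolation of `θ₀, …, θ_N` at the
grid points `t₀ < … < t_N`, continued by the constant `θ_N` after `t_N`. -/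
def interpolate {p : ℕ} (s : ℕ → State p) : ℕ → ℝ≥0∞ → Param p
  | 0, _ => (s 0).iterate
  | n + 1, t =>
    if t ≤ ENNReal.ofReal (s n).time then interpolate s n t
    else if t ≤ ENNReal.ofReal (s (n + 1)).time then
      (((s (n + 1)).time - t.toReal) / ((s (n + 1)).time - (s n).time)) • (s n).iterate
        + ((t.toReal - (s n).time) / ((s (n + 1)).time - (s n).time)) • (s (n + 1)).iterate
    else (s (n + 1)).iterate

end NewtonPath

end

open Set
open scoped ENNReal RealInnerProductSpace

noncomputable section

namespace NewtonPath

/-! Put s = e^t - 1. Then e^t f_t = s L + ½‖·‖² is 1-strongly convex, and its gradient g = s∇L(x) +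
x (`scaledGrad`) serves as the residual. Strong convexity bounds the gap in f_t by e^{-t}‖g‖²/2
(`objective_sub_le`), so it is enough to keep ‖g‖ of order √ε e^{t/2}.

The Newton equation is (sH + I)δ = -g. On the spectrum of H, y^γ ≤ s^{-γ}(1 + sy)², which turns both
quadratic forms of the local Lipschitz condition into multiples of ‖g‖². Hence a Newton step with
small residual stays in D and shrinks the residual quadratically (`newton_step`). Replacing s by (1
+ h)s with x fixed turns g into (1 + h)g - hx, so the step rule only has to limit h‖x‖. These two
effects balance in the invariant `Tracks`, which `Tracks.step` propagates; γ₁ ≥ 1 makes the factor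
s^{1-γ₁} nonincreasing. The first step starts at x = 0, where an error relative to ‖x‖ is
meaningless; the constant C₁ is there for it (`tracks_first`).

For the count, iterates before termination are bounded through the solution at the final time, which
yields α_{k+1} ≥ κ(e^{α₁} - 1)e^{t_k/2} with κ independent of ε (`exists_le_stepSize`). So e^{-t/2},
which starts at 1, drops by at least κ(e^{α₁} - 1)/4 at every step, and N = O(1/α₁) even on an
infinite time interval. If the algorithm stops because ‖θ_N‖²/(e^{t_N} - 1) is small, θ_N stays near
optimal for all later times (`Tracks.objective_sub_le_of_terminates`). -/

variable {p : ℕ}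

/-! ### Quadratic forms of operator powers -/

/-- A quadratic form built from `opPow` is dominated as soon as the scalar power is dominated by a
quadratic polynomial on the spectrum. -/
theorem inner_opPow_le {A : Param p →L[ℝ] Param p} (hA : IsSelfAdjoint A) {γ a b c : ℝ}
    (h : ∀ x ∈ spectrum ℝ A, x ^ γ ≤ a + b * x + c * x ^ 2) (δ : Param p) :
    ⟪δ, opPow A γ δ⟫ ≤ a * ‖δ‖ ^ 2 + b * ⟪δ, A δ⟫ + c * ‖A δ‖ ^ 2 := by
  set Φ := Matrix.toEuclideanCLM (n := Fin p) (𝕜 := ℝ) with hΦ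
  set M := Φ.symm A with hM
  have hMA : Φ M = A := by simp [hM]
  have hMs : IsSelfAdjoint M := by
    apply EquivLike.injective Φ
    rw [map_star, hMA, hA.star_eq]
  have hspec : spectrum ℝ M = spectrum ℝ A := AlgEquiv.spectrum_eq Φ.symm.toAlgEquiv A
  have hfin : (spectrum ℝ M).Finite := Matrix.finite_real_spectrum
  have hcont : ∀ f : ℝ → ℝ, ContinuousOn f (spectrum ℝ M) := fun f => hfin.continuousOn f
  set q : ℝ → ℝ := fun x => a + b * x + c * x ^ 2 with hq
  -- The gap q - x^γ is a square on the spectrum, so the difference of the two quadratic forms is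
  -- ‖w(M)δ‖² ≥ 0. The spectrum is finite, so continuity of these functions on it is automatic.
  set w : ℝ → ℝ := fun x => Real.sqrt (q x - x ^ γ) with hw
  have h1 : cfc q M - cfc (fun x : ℝ => x ^ γ) M = cfc w M * cfc w M := by
    rw [← cfc_sub q _ M (hcont _) (hcont _), ← cfc_mul w w M (hcont _) (hcont _)]
    apply cfc_congr
    intro x hx
    have := h x (hspec ▸ hx)
    simp only [hw, hq]
    rw [Real.mul_self_sqrt]
    linarith
  have h2 : cfc q M = a • (1 : Matrix (Fin p) (Fin p) ℝ) + b • M + c • (M * M) := by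
    have e1 : cfc q M = cfc (fun x : ℝ => (a + b * x) + c * x ^ 2) M := rfl
    rw [e1, cfc_add M (fun x : ℝ => a + b * x) (fun x => c * x ^ 2) (hcont _) (hcont _),
      cfc_add M (fun _ : ℝ => a) (fun x => b * x) (hcont _) (hcont _),
      cfc_const a M hMs, cfc_const_mul b (fun x : ℝ => x) M (hcont _),
      cfc_const_mul c (fun x : ℝ => x ^ 2) M (hcont _), cfc_id' ℝ M hMs,
      cfc_pow_id (R := ℝ) M 2 hMs, Algebra.algebraMap_eq_smul_one, pow_two]
  have hws : IsSelfAdjoint (Φ (cfc w M)) := by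
    rw [IsSelfAdjoint, ← map_star, (cfc_predicate w M : IsSelfAdjoint _).star_eq]
  have h3 : Φ (cfc q M) δ - opPow A γ δ = Φ (cfc w M) (Φ (cfc w M) δ) := by
    have := congrArg (fun B => Φ B δ) h1
    simpa [map_sub, map_mul, opPow] using this
  have h4 : Φ (cfc q M) δ = a • δ + b • A δ + c • A (A δ) := by
    rw [h2]
    simp [map_add, map_smul, map_mul, hMA]
  have h5 : ⟪δ, Φ (cfc w M) (Φ (cfc w M) δ)⟫ = ‖Φ (cfc w M) δ‖ ^ 2 := by
    rw [← real_inner_self_eq_norm_sq]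
    exact (hws.isSymmetric δ (Φ (cfc w M) δ)).symm
  have h6 : ⟪δ, A (A δ)⟫ = ‖A δ‖ ^ 2 := by
    rw [← real_inner_self_eq_norm_sq]
    exact (hA.isSymmetric δ (A δ)).symm
  have h7 : ⟪δ, Φ (cfc q M) δ - opPow A γ δ⟫ = ‖Φ (cfc w M) δ‖ ^ 2 := by rw [h3, h5]
  rw [h4, inner_sub_right, inner_add_right, inner_add_right, inner_smul_right, inner_smul_right,
    inner_smul_right, h6, real_inner_self_eq_norm_sq] at h7
  nlinarith [sq_nonneg ‖Φ (cfc w M) δ‖]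

/-- The spectrum of a positive operator is nonnegative. -/
theorem spectrum_nonneg_of_inner_nonneg {A : Param p →L[ℝ] Param p} (hA : IsSelfAdjoint A)
    (h : ∀ v, 0 ≤ ⟪v, A v⟫) {x : ℝ} (hx : x ∈ spectrum ℝ A) : 0 ≤ x := by
  have hpos : A.IsPositive := by
    rw [ContinuousLinearMap.isPositive_iff]
    exact ⟨hA.isSymmetric, fun v => by rw [real_inner_comm]; exact h v⟩
  exact SpectrumRestricts.nnreal_iff.1 hpos.spectrumRestricts x hx

/-! ### First- and second-order consequences of convexity -/

theorem LocalLipschitzHessian.first_order {L : Param p → ℝ} {D : Set (Param p)} {β γ₁ γ₂ : ℝ}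
    (hL : LocalLipschitzHessian L D β γ₁ γ₂) {x y : Param p} (hx : x ∈ D) (hy : y ∈ D) :
    L x + ⟪gradient L x, y - x⟫ ≤ L y := by
  set φ : ℝ → ℝ := fun τ => L (AffineMap.lineMap x y τ) with hφ
  have hconv : ConvexOn ℝ ((AffineMap.lineMap x y : ℝ →ᵃ[ℝ] Param p) ⁻¹' D) φ :=
    hL.convex.comp_affineMap (AffineMap.lineMap x y)
  have hd : HasDerivAt φ ⟪gradient L x, y - x⟫ 0 := by
    have h1 : HasFDerivAt L (InnerProductSpace.toDual ℝ _ (gradient L x))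
        ((AffineMap.lineMap x y : ℝ →ᵃ[ℝ] Param p) 0) := by
      rw [AffineMap.lineMap_apply_zero]
      exact (hL.differentiable x hx).hasGradientAt.hasFDerivAt
    have h2 : HasDerivAt (fun τ : ℝ => (AffineMap.lineMap x y : ℝ →ᵃ[ℝ] Param p) τ) (y - x) 0 :=
      AffineMap.hasDerivAt_lineMap
    have h3 := h1.comp_hasDerivAt 0 h2
    rw [InnerProductSpace.toDual_apply_apply] at h3
    exact h3
  have := hconv.le_slope_of_hasDerivAt (x := 0) (y := 1) (by simpa using hx) (by simpa using hy)
    one_pos hd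
  simp only [slope_def_field, hφ, AffineMap.lineMap_apply_one, AffineMap.lineMap_apply_zero,
    sub_zero, div_one] at this
  linarith

theorem LocalLipschitzHessian.gradient_monotone {L : Param p → ℝ} {D : Set (Param p)}
    {β γ₁ γ₂ : ℝ}
    (hL : LocalLipschitzHessian L D β γ₁ γ₂) {x y : Param p} (hx : x ∈ D) (hy : y ∈ D) :
    0 ≤ ⟪gradient L y - gradient L x, y - x⟫ := by
  have h1 := hL.first_order hx hy
  have h2 := hL.first_order hy hx
  rw [inner_sub_left]
  rw [← neg_sub y x, inner_neg_right] at h2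
  linarith

/-- Differentiability of L near x and of its gradient at x already gives symmetry; the Hessian need
not be continuous. -/
theorem LocalLipschitzHessian.isSelfAdjoint_hess {L : Param p → ℝ} {D : Set (Param p)}
    {β γ₁ γ₂ : ℝ}
    (hL : LocalLipschitzHessian L D β γ₁ γ₂) {x : Param p} (hx : x ∈ D) :
    IsSelfAdjoint (hess L x) := by
  rw [ContinuousLinearMap.isSelfAdjoint_iff_isSymmetric]
  intro v w
  have h1 : ∀ᶠ y in nhds x, HasFDerivAt L (innerSL ℝ (gradient L y)) y := by
    filter_upwards [hL.isOpen_dom.mem_nhds hx] with y hy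
    exact (hL.differentiable y hy).hasGradientAt.hasFDerivAt
  have h2 : HasFDerivAt (fun y => innerSL ℝ (gradient L y))
      ((innerSL ℝ).comp (hess L x)) x :=
    (innerSL ℝ).hasFDerivAt.comp x (hL.twice_differentiable x hx).hasFDerivAt
  have := second_derivative_symmetric_of_eventually h1 h2 v w
  simp at this
  simpa [real_inner_comm] using this

theorem LocalLipschitzHessian.inner_hess_nonneg {L : Param p → ℝ} {D : Set (Param p)}
    {β γ₁ γ₂ : ℝ}
    (hL : LocalLipschitzHessian L D β γ₁ γ₂) {x : Param p} (hx : x ∈ D) (v : Param p) :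
    0 ≤ ⟪v, hess L x v⟫ := by
  have h2 : HasLineDerivAt ℝ (gradient L) (hess L x v) x v :=
    (hL.twice_differentiable x hx).hasFDerivAt.hasLineDerivAt v
  have h3 := h2.tendsto_slope_zero_right
  have h4 := (tendsto_const_nhds (x := v)).inner (𝕜 := ℝ) h3
  refine ge_of_tendsto h4 ?_
  have hc : Filter.Tendsto (fun τ : ℝ => x + τ • v) (nhdsWithin 0 (Ioi 0)) (nhds x) := by
    have : Continuous (fun τ : ℝ => x + τ • v) := by fun_prop
    have := this.tendsto 0
    simp at this
    exact this.mono_left nhdsWithin_le_nhds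
  filter_upwards [hc.eventually (hL.isOpen_dom.mem_nhds hx), self_mem_nhdsWithin] with τ hτ hpos
  have := hL.gradient_monotone hx hτ
  simp only [add_sub_cancel_left, inner_smul_right] at this
  rw [inner_smul_right, real_inner_comm]
  have hpos : 0 < τ := hpos
  have := nonneg_of_mul_nonneg_right this hpos
  positivity

/-! ### The scaled gradient and a single Newton step -/

/-- `s ∇L(x) + x`, the gradient of `s L + ½ ‖·‖²`; for `s = e^t - 1` it is `e^t` times the gradient
of the scaled objective `f_t`. -/
def scaledGrad (L : Param p → ℝ) (s : ℝ) (x : Param p) : Param p := s • gradient L x + x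

theorem rpow_le_one_add_sq {x γ : ℝ} (hx : 0 ≤ x) (h0 : 0 ≤ γ) (h2 : γ ≤ 2) :
    x ^ γ ≤ (1 + x) ^ 2 := by
  calc x ^ γ ≤ (1 + x) ^ γ := Real.rpow_le_rpow hx (by linarith) h0
    _ ≤ (1 + x) ^ (2 : ℝ) := Real.rpow_le_rpow_of_exponent_le (by linarith) h2
    _ = (1 + x) ^ 2 := by norm_num

theorem rpow_le_rpow_neg_mul {x s γ : ℝ} (hx : 0 ≤ x) (hs : 0 < s) (h0 : 0 ≤ γ) (h2 : γ ≤ 2) :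
    x ^ γ ≤ s ^ (-γ) * (1 + s * x) ^ 2 := by
  have h := rpow_le_one_add_sq (mul_nonneg hs.le hx) h0 h2
  rw [Real.mul_rpow hs.le hx] at h
  have h3 : x ^ γ = s ^ (-γ) * (s ^ γ * x ^ γ) := by
    rw [← mul_assoc, ← Real.rpow_add hs]; simp
  rw [h3]
  exact mul_le_mul_of_nonneg_left h (Real.rpow_nonneg hs.le _)

section

variable {L : Param p → ℝ} {D : Set (Param p)} {β γ₁ γ₂ : ℝ}

namespace LocalLipschitzHessian

/-- The polynomial (1 + sy)² dominating s^γ y^γ is the one whose quadratic form is ‖(sH + I)δ‖². For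
a Newton step this is the squared residual. -/
theorem inner_opPow_hess_le (hL : LocalLipschitzHessian L D β γ₁ γ₂) {x : Param p} (hx : x ∈ D)
    {s γ : ℝ} (hs : 0 < s) (h0 : 0 ≤ γ) (h2 : γ ≤ 2) (δ : Param p) :
    ⟪δ, opPow (hess L x) γ δ⟫ ≤ s ^ (-γ) * ‖s • hess L x δ + δ‖ ^ 2 := by
  have hA := hL.isSelfAdjoint_hess hx
  have h := inner_opPow_le hA (γ := γ) (a := s ^ (-γ)) (b := s ^ (-γ) * (2 * s))
    (c := s ^ (-γ) * s ^ 2) (fun y hy => by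
      have := rpow_le_rpow_neg_mul
        (spectrum_nonneg_of_inner_nonneg hA (hL.inner_hess_nonneg hx) hy) hs h0 h2
      linarith) δ
  have h3 : ‖s • hess L x δ + δ‖ ^ 2
      = s ^ 2 * ‖hess L x δ‖ ^ 2 + 2 * s * ⟪δ, hess L x δ⟫ + ‖δ‖ ^ 2 := by
    rw [norm_add_sq_real, norm_smul, inner_smul_left, real_inner_comm, Real.norm_of_nonneg hs.le]
    simp; ring
  rw [h3]
  linarith

/-- Domination of the power by an affine function on the spectrum. -/
theorem inner_opPow_hess_le_affine (hL : LocalLipschitzHessian L D β γ₁ γ₂) {x : Param p}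
    (hx : x ∈ D) {s γ C : ℝ}
    (h : ∀ y ∈ spectrum ℝ (hess L x), y ^ γ ≤ C * (1 + s * y)) (δ : Param p) :
    ⟪δ, opPow (hess L x) γ δ⟫ ≤ C * ⟪δ, s • hess L x δ + δ⟫ := by
  have h := inner_opPow_le (hL.isSelfAdjoint_hess hx) (γ := γ) (a := C) (b := C * s) (c := 0)
    (fun y hy => by have := h y hy; linarith) δ
  rw [inner_add_right, inner_smul_right, real_inner_self_eq_norm_sq]
  linarith

theorem norm_le_norm_hess_add (hL : LocalLipschitzHessian L D β γ₁ γ₂) {x : Param p} (hx : x ∈ D)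
    {s : ℝ} (hs : 0 ≤ s) (δ : Param p) :
    ‖δ‖ ^ 2 ≤ ⟪δ, s • hess L x δ + δ⟫ ∧ ‖δ‖ ≤ ‖s • hess L x δ + δ‖ := by
  have h1 : ‖δ‖ ^ 2 ≤ ⟪δ, s • hess L x δ + δ⟫ := by
    rw [inner_add_right, inner_smul_right, real_inner_self_eq_norm_sq]
    have := mul_nonneg hs (hL.inner_hess_nonneg hx δ)
    linarith
  refine ⟨h1, ?_⟩
  have h2 := h1.trans (real_inner_le_norm δ _)
  rcases (norm_nonneg δ).eq_or_lt with h | h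
  · rw [← h]; positivity
  · rw [pow_two] at h2; exact le_of_mul_le_mul_left h2 h

/-- A step satisfying the local condition stays in the domain. -/
theorem add_mem (hL : LocalLipschitzHessian L D β γ₁ γ₂) {x δ : Param p} (hx : x ∈ D)
    (hδ : ⟪δ, opPow (hess L x) γ₂ δ⟫ ≤ (β ^ 2)⁻¹) : x + δ ∈ D := by
  have hβ := hL.beta_pos
  set q₁ := ⟪δ, opPow (hess L x) γ₁ δ⟫ with hq₁
  set B := ‖gradient L x‖ + ‖hess L x δ‖ + β * |q₁| with hB
  have hscale : ∀ (γ τ : ℝ), ⟪τ • δ, opPow (hess L x) γ (τ • δ)⟫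
      = τ ^ 2 * ⟪δ, opPow (hess L x) γ δ⟫ := by
    intro γ τ
    rw [map_smul, inner_smul_left, inner_smul_right]; simp; ring
  -- The quadratic form scales by τ² ≤ 1, so the local condition holds along the whole segment. It
  -- bounds the gradient by B wherever the segment is in D, and convexity then bounds L.
  have hbound : ∀ τ ∈ Icc (0 : ℝ) 1, x + τ • δ ∈ D → L (x + τ • δ) ≤ L x + B * ‖δ‖ := by
    intro τ hτ hm
    have hτ2 : τ ^ 2 ≤ 1 := by nlinarith [hτ.1, hτ.2]
    have h1 := hL.local_lipschitz x hx (τ • δ) hm (by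
      rw [hscale]
      have : 0 ≤ (β ^ 2)⁻¹ := by positivity
      rcases le_total 0 ⟪δ, opPow (hess L x) γ₂ δ⟫ with h | h
      · nlinarith
      · nlinarith [sq_nonneg τ])
    rw [hscale, map_smul] at h1
    have h2 : ‖gradient L (x + τ • δ)‖ ≤ B := by
      have e : gradient L (x + τ • δ) = (gradient L (x + τ • δ) - gradient L x - τ • hess L x δ)
        + gradient L x + τ • hess L x δ := by abel
      have h3 : β * (τ ^ 2 * q₁) ≤ β * |q₁| := by
        apply mul_le_mul_of_nonneg_left _ hβ.le
        nlinarith [le_abs_self q₁, abs_nonneg q₁, sq_nonneg τ]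
      have h4 : ‖τ • hess L x δ‖ ≤ ‖hess L x δ‖ := by
        rw [norm_smul, Real.norm_of_nonneg hτ.1]
        exact mul_le_of_le_one_left (norm_nonneg _) hτ.2
      rw [e, hB]
      refine (norm_add₃_le).trans ?_
      linarith
    have h5 := hL.first_order hm hx
    have h6 : ⟪gradient L (x + τ • δ), x - (x + τ • δ)⟫
        = -⟪gradient L (x + τ • δ), τ • δ⟫ := by
      rw [← inner_neg_right]; congr 1; abel
    have h7 := real_inner_le_norm (gradient L (x + τ • δ)) (τ • δ)
    have h8 : ‖τ • δ‖ ≤ ‖δ‖ := by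
      rw [norm_smul, Real.norm_of_nonneg hτ.1]
      exact mul_le_of_le_one_left (norm_nonneg _) hτ.2
    have h9 : ‖gradient L (x + τ • δ)‖ * ‖τ • δ‖ ≤ B * ‖δ‖ :=
      mul_le_mul h2 h8 (norm_nonneg _) (by positivity)
    linarith
  set T : Set ℝ := {τ | x + τ • δ ∈ D} with hT
  have hcont : Continuous (fun τ : ℝ => x + τ • δ) := by fun_prop
  have hopen : IsOpen T := hL.isOpen_dom.preimage hcont
  set T' : Set ℝ := {τ | x + τ • δ ∈ D ∧ L (x + τ • δ) ≤ L x + B * ‖δ‖} with hT'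
  have hclosed : IsClosed T' :=
    hL.closed.preimage (f := fun τ : ℝ => (x + τ • δ, L x + B * ‖δ‖)) (by fun_prop)
  -- Continuity argument: D is open, while the bound on L and the closed epigraph make the set of
  -- admissible τ closed in [0, 1].
  have hsub : Icc (0 : ℝ) 1 ⊆ T := by
    have hTT : T ∩ Icc 0 1 = T' ∩ Icc 0 1 := by
      ext τ
      exact ⟨fun h => ⟨⟨h.1, hbound τ h.2 h.1⟩, h.2⟩, fun h => ⟨h.1.1, h.2⟩⟩
    apply IsClosed.Icc_subset_of_forall_mem_nhdsWithin
    · rw [hTT]; exact hclosed.inter isClosed_Icc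
    · simpa [hT] using hx
    · exact fun τ hτ => mem_nhdsWithin_of_mem_nhds (hopen.mem_nhds hτ.1)
  simpa [hT] using hsub (right_mem_Icc.2 zero_le_one)

/-- The Newton equation cancels the linear part, so the new residual is exactly s times the Taylor
remainder of the gradient. -/
theorem gradient_add_sub_le (hL : LocalLipschitzHessian L D β γ₁ γ₂) {x δ : Param p} (hx : x ∈ D)
    {s : ℝ} (hs : 0 < s) (hstep : s • hess L x δ + δ = -scaledGrad L s x)
    (hδ : ⟪δ, opPow (hess L x) γ₂ δ⟫ ≤ (β ^ 2)⁻¹) :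
    x + δ ∈ D ∧ ‖scaledGrad L s (x + δ)‖ ≤ s * (β * ⟪δ, opPow (hess L x) γ₁ δ⟫) := by
  have hm := hL.add_mem hx hδ
  refine ⟨hm, ?_⟩
  have h := hL.local_lipschitz x hx δ hm hδ
  have e : scaledGrad L s (x + δ) = s • (gradient L (x + δ) - gradient L x - hess L x δ) := by
    have h2 : scaledGrad L s (x + δ)
      = s • (gradient L (x + δ) - gradient L x - hess L x δ)
        + (s • hess L x δ + δ) + scaledGrad L s x := by
      simp only [scaledGrad, smul_sub]; abel
    rw [h2, hstep]; abel
  rw [e, norm_smul, Real.norm_of_nonneg hs.le]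
  exact mul_le_mul_of_nonneg_left h hs.le

theorem inner_opPow_le_inv_sq (hL : LocalLipschitzHessian L D β γ₁ γ₂) {x δ : Param p}
    (hx : x ∈ D) {s : ℝ} (hs : 0 < s) (hstep : s • hess L x δ + δ = -scaledGrad L s x)
    (h2 : β * s ^ (-(γ₂ / 2)) * ‖scaledGrad L s x‖ ≤ 1) :
    ⟪δ, opPow (hess L x) γ₂ δ⟫ ≤ (β ^ 2)⁻¹ := by
  have hβ := hL.beta_pos
  have h := hL.inner_opPow_hess_le hx hs hL.gamma_two_mem.1 hL.gamma_two_mem.2.le δ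
  rw [hstep, norm_neg] at h
  refine h.trans ?_
  have e : s ^ (-γ₂) = (s ^ (-(γ₂ / 2))) ^ 2 := by
    rw [← Real.rpow_natCast, ← Real.rpow_mul hs.le]; congr 1; push_cast; ring
  rw [e, ← mul_pow, ← inv_pow]
  have h0 : 0 ≤ s ^ (-(γ₂ / 2)) := Real.rpow_nonneg hs.le _
  apply pow_le_pow_left₀ (by positivity)
  rw [← one_div, le_div_iff₀ hβ]
  linarith

/-- One Newton step reduces the scaled gradient by the factor `μ`. -/
theorem newton_step (hL : LocalLipschitzHessian L D β γ₁ γ₂) {x δ : Param p} (hx : x ∈ D)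
    {s μ : ℝ} (hs : 0 < s) (hstep : s • hess L x δ + δ = -scaledGrad L s x)
    (h1 : β * s ^ (1 - γ₁) * ‖scaledGrad L s x‖ ≤ μ)
    (h2 : β * s ^ (-(γ₂ / 2)) * ‖scaledGrad L s x‖ ≤ 1) :
    x + δ ∈ D ∧ ‖scaledGrad L s (x + δ)‖ ≤ μ * ‖scaledGrad L s x‖ := by
  have hβ := hL.beta_pos
  have hδ := hL.inner_opPow_le_inv_sq hx hs hstep h2
  obtain ⟨hm, h⟩ := hL.gradient_add_sub_le hx hs hstep hδ
  refine ⟨hm, h.trans ?_⟩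
  have h3 := hL.inner_opPow_hess_le hx hs hL.gamma_one_mem.1 hL.gamma_one_mem.2.le δ
  rw [hstep, norm_neg] at h3
  have e : s ^ (1 - γ₁) = s * s ^ (-γ₁) := by
    rw [sub_eq_add_neg, Real.rpow_add hs, Real.rpow_one]
  calc s * (β * ⟪δ, opPow (hess L x) γ₁ δ⟫)
      ≤ s * (β * (s ^ (-γ₁) * ‖scaledGrad L s x‖ ^ 2)) := by gcongr
    _ = (β * s ^ (1 - γ₁) * ‖scaledGrad L s x‖) * ‖scaledGrad L s x‖ := by rw [e]; ring
    _ ≤ μ * ‖scaledGrad L s x‖ := by gcongr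

/-- Multiplication by e^t turns the system for f_t into (sH + I)δ = -g. The operator is injective in
finite dimension, so `inverse` is a true inverse and not its default value 0. -/
theorem newtonUpdate_spec (hL : LocalLipschitzHessian L D β γ₁ γ₂) {x : Param p} (hx : x ∈ D)
    {t : ℝ} (ht : 0 ≤ t) :
    (Real.exp t - 1) • hess L x (newtonUpdate L t x - x) + (newtonUpdate L t x - x)
      = -scaledGrad L (Real.exp t - 1) x := by
  set A : Param p →L[ℝ] Param p := (1 - Real.exp (-t)) • hess L x
        + Real.exp (-t) • ContinuousLinearMap.id ℝ (Param p) with hA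
  have hu : 0 < Real.exp (-t) := Real.exp_pos _
  have hee : Real.exp t * Real.exp (-t) = 1 := by rw [← Real.exp_add]; simp
  have hscale : ∀ v, Real.exp t • A v = (Real.exp t - 1) • hess L x v + v := by
    intro v
    simp only [hA, _root_.add_apply, _root_.smul_apply,
      ContinuousLinearMap.id_apply, smul_add, smul_smul]
    rw [mul_sub, hee]; simp
  have hinj : Function.Injective A := by
    rw [injective_iff_map_eq_zero]
    intro v hv
    have h := (hL.norm_le_norm_hess_add hx (s := Real.exp t - 1)
      (by linarith [Real.one_le_exp ht]) v).2
    rw [← hscale, hv] at h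
    simpa using h
  have hinv : A.IsInvertible :=
    ⟨(LinearEquiv.ofInjectiveEndo A.toLinearMap hinj).toContinuousLinearEquiv, by ext; rfl⟩
  have hδ : newtonUpdate L t x - x = - A.inverse ((1 - Real.exp (-t)) • gradient L x
      + Real.exp (-t) • x) := by
    simp only [newtonUpdate, ← hA]; abel
  rw [← hscale, hδ, map_neg, hinv.self_apply_inverse, scaledGrad]
  simp only [smul_neg, smul_add, smul_smul]
  rw [mul_sub, hee]; simp

/-- The scaled objective is strongly convex. -/
theorem scaled_first_order (hL : LocalLipschitzHessian L D β γ₁ γ₂) {x y : Param p} (hx : x ∈ D)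
    (hy : y ∈ D) {s : ℝ} (hs : 0 ≤ s) :
    s * L x + ‖x‖ ^ 2 / 2 + ⟪scaledGrad L s x, y - x⟫ + ‖y - x‖ ^ 2 / 2
      ≤ s * L y + ‖y‖ ^ 2 / 2 := by
  have h := mul_le_mul_of_nonneg_left (hL.first_order hx hy) hs
  have h2 : ‖y‖ ^ 2 = ‖x‖ ^ 2 + 2 * ⟪x, y - x⟫ + ‖y - x‖ ^ 2 := by
    rw [← norm_add_sq_real]; simp
  rw [scaledGrad, inner_add_left, inner_smul_left, h2]
  simp only [conj_trivial]
  linarith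

theorem norm_sub_le_scaledGrad (hL : LocalLipschitzHessian L D β γ₁ γ₂) {x y : Param p}
    (hx : x ∈ D) (hy : y ∈ D) {s : ℝ} (hs : 0 ≤ s) :
    ‖y - x‖ ≤ ‖scaledGrad L s y - scaledGrad L s x‖ := by
  have h := hL.gradient_monotone hx hy
  have h1 : ‖y - x‖ ^ 2 ≤ ⟪scaledGrad L s y - scaledGrad L s x, y - x⟫ := by
    have e : scaledGrad L s y - scaledGrad L s x
      = s • (gradient L y - gradient L x) + (y - x) := by
      simp only [scaledGrad, smul_sub]; abel
    rw [e, inner_add_left, inner_smul_left, real_inner_self_eq_norm_sq]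
    simp only [conj_trivial]
    nlinarith
  have h2 := h1.trans (real_inner_le_norm _ _)
  rcases (norm_nonneg (y - x)).eq_or_lt with h | h
  · rw [← h]; positivity
  · rw [pow_two] at h2; exact le_of_mul_le_mul_right h2 h

/-- Complete the square in the strong convexity lower bound. -/
theorem scaled_sub_le (hL : LocalLipschitzHessian L D β γ₁ γ₂) {x y : Param p} (hx : x ∈ D)
    (hy : y ∈ D) {s : ℝ} (hs : 0 ≤ s) :
    (s * L x + ‖x‖ ^ 2 / 2) - (s * L y + ‖y‖ ^ 2 / 2) ≤ ‖scaledGrad L s x‖ ^ 2 / 2 := by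
  have h := hL.scaled_first_order hx hy hs
  have h2 := norm_add_sq_real (scaledGrad L s x) (y - x)
  nlinarith [sq_nonneg ‖scaledGrad L s x + (y - x)‖]

/-- With x fixed, a change of time perturbs the residual, beyond a rescaling, only by a multiple of
x. This is why ‖x‖ governs the admissible step sizes. -/
theorem scaledGrad_rescale {s s' : ℝ} (hs : s ≠ 0) (x : Param p) :
    scaledGrad L s' x = (s' / s) • scaledGrad L s x - (s' / s - 1) • x := by
  simp only [scaledGrad, smul_add, smul_smul, sub_smul, one_smul]
  rw [div_mul_cancel₀ _ hs]; abel

end LocalLipschitzHessian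

end

/-! ### The invariant and its propagation -/

/-- This is where the doubling cap on step sizes enters: it yields h ≤ 3 for the relative growth h
of e^t - 1. -/
theorem exp_sub_one_le_of_le_two_mul {α α' t : ℝ} (h1 : α' ≤ 1 / 10) (h2 : α' ≤ 2 * α)
    (ht : α ≤ t) (ht0 : 0 < t) : Real.exp α' - 1 ≤ 3 * (1 - Real.exp (-t)) := by
  rcases le_total α' 0 with h | h
  · have := Real.exp_le_one_iff.2 h
    have := Real.exp_le_one_iff.2 (neg_nonpos.2 ht0.le)
    linarith
  · set E := Real.exp (α' / 2) with hE
    have hE1 : 1 ≤ E := Real.one_le_exp (by linarith)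
    have hEE : Real.exp α' = E * E := by rw [hE, ← Real.exp_add]; congr 1; ring
    have hm : Real.exp (-t) ≤ Real.exp (-(α' / 2)) := Real.exp_le_exp.2 (by linarith)
    rw [Real.exp_neg (α' / 2), ← hE] at hm
    -- 20/19 = 1/(1 - 1/20), since α'/2 ≤ 1/20; then E(E + 1) < 3 below.
    have hEu : E ≤ 20 / 19 := by
      have h3 := Real.one_sub_le_exp_neg (α' / 2)
      rw [Real.exp_neg, ← hE] at h3
      have h4 : E * E⁻¹ = 1 := mul_inv_cancel₀ (by linarith)
      nlinarith
    have h5 : E * E⁻¹ = 1 := mul_inv_cancel₀ (by linarith)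
    have h6 : 0 < E⁻¹ := by positivity
    have h7 : E * E - 1 ≤ 3 * (1 - E⁻¹) := by
      have : 3 * (1 - E⁻¹) - (E * E - 1) = (E - 1) * E⁻¹ * (3 - E * (E + 1)) := by
        field_simp; ring
      have h8 : 0 ≤ (E - 1) * E⁻¹ * (3 - E * (E + 1)) := by
        apply mul_nonneg (mul_nonneg (by linarith) h6.le)
        nlinarith
      linarith
    rw [hEE]
    linarith

/-- If δ is short, the triangle inequality suffices. If it is long, the hypothesis forces ⟪δ, x⟫ >
0, so adding δ lengthens x. This keeps Newton iterates away from 0 even when ‖δ‖ exceeds ‖x‖. -/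
theorem norm_sub_le_norm_add_of_sq_le {E : Type*} [NormedAddCommGroup E] [InnerProductSpace ℝ E]
    {x δ g : E} {h c : ℝ} (hh : 0 ≤ h) (hc : 0 ≤ c) (hδ : ‖δ‖ ^ 2 ≤ ⟪δ, h • x - c • g⟫) :
    ‖x‖ - c * ‖g‖ ≤ ‖x + δ‖ := by
  rcases le_or_gt ‖δ‖ (c * ‖g‖) with hcase | hcase
  · have h1 : ‖x‖ - ‖δ‖ ≤ ‖x + δ‖ := by simpa using norm_sub_norm_le x (-δ)
    linarith
  · rw [inner_sub_right, inner_smul_right, inner_smul_right] at hδ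
    have h2 := mul_le_mul_of_nonneg_left (neg_le_of_abs_le (abs_real_inner_le_norm δ g)) hc
    have h0 : 0 ≤ c * ‖g‖ := by positivity
    have h4 : ‖δ‖ * (c * ‖g‖) < ‖δ‖ * ‖δ‖ := mul_lt_mul_of_pos_left hcase (h0.trans_lt hcase)
    have h5 : 0 < h * ⟪δ, x⟫ := by linarith
    have h6 : 0 ≤ ⟪δ, x⟫ := (pos_of_mul_pos_right h5 hh).le
    have h7 : ‖x‖ ^ 2 ≤ ‖x + δ‖ ^ 2 := by
      rw [norm_add_sq_real, real_inner_comm]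
      linarith [sq_nonneg ‖δ‖]
    have := (sq_le_sq₀ (norm_nonneg _) (norm_nonneg _)).1 h7
    linarith

/-- The conditions that the algorithm maintains: `x` is an approximate minimizer of `f_t`, with a
relative error, with an error small enough for Newton's method to contract, and with an error
of the order of the target precision. -/
structure Tracks (L : Param p → ℝ) (D : Set (Param p)) (β γ₁ γ₂ A t : ℝ) (x : Param p) :
    Prop where
  time_pos : 0 < t
  mem : x ∈ D
  ne_zero : x ≠ 0
  relative : ‖scaledGrad L (Real.exp t - 1) x‖ ≤ ‖x‖ / 12
  contract_one : β * (Real.exp t - 1) ^ (1 - γ₁) * ‖scaledGrad L (Real.exp t - 1) x‖ ≤ 1 / 1000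
  contract_two :
    β * (Real.exp t - 1) ^ (-(γ₂ / 2)) * ‖scaledGrad L (Real.exp t - 1) x‖ ≤ 1 / 1000
  accuracy : ‖scaledGrad L (Real.exp t - 1) x‖ ≤ A * Real.exp (t / 2) / 20

/-- Bounds on a step of the algorithm from time `t` at `x`, in terms of the relative growth `h` of
`e^t - 1`. -/
structure StepBounds (β γ₁ γ₂ A t h : ℝ) (x : Param p) : Prop where
  nonneg : 0 ≤ h
  le_three : h ≤ 3
  accuracy : h * ‖x‖ ≤ A * Real.exp (t / 2)
  contract_one : h * (β * (Real.exp t - 1) ^ (1 - γ₁) * ‖x‖) ≤ 1 / 442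
  contract_two : h * (β * (Real.exp t - 1) ^ (-(γ₂ / 2)) * ‖x‖) ≤ 1 / 442

section

variable {L : Param p → ℝ} {D : Set (Param p)} {β γ₁ γ₂ A t : ℝ}

theorem norm_scaledGrad_rescale_le {s s' h : ℝ} (hs : 0 < s) (hs' : s' = (1 + h) * s)
    (hh : 0 ≤ h) (x : Param p) :
    ‖scaledGrad L s' x‖ ≤ (1 + h) * ‖scaledGrad L s x‖ + h * ‖x‖ := by
  rw [LocalLipschitzHessian.scaledGrad_rescale hs.ne' x, hs', mul_div_cancel_right₀ _ hs.ne',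
    add_sub_cancel_left]
  refine (norm_sub_le _ _).trans ?_
  rw [norm_smul, norm_smul, Real.norm_of_nonneg hh, Real.norm_of_nonneg (by linarith)]

/-- Moving in time inflates the residual by a bounded factor, since h ≤ 3, and the Newton step then
multiplies it by 7/1000. That more than restores all four error bounds. -/
theorem Tracks.step (hL : LocalLipschitzHessian L D β γ₁ γ₂) (hγ₁ : 1 ≤ γ₁) {x : Param p}
    (hx : Tracks L D β γ₁ γ₂ A t x) {t' h : ℝ} (hb : StepBounds β γ₁ γ₂ A t h x)
    (htt : t ≤ t') (hA : 0 ≤ A) (hs' : Real.exp t' - 1 = (1 + h) * (Real.exp t - 1)) :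
    Tracks L D β γ₁ γ₂ A t' (newtonUpdate L t' x) ∧ ‖newtonUpdate L t' x‖ ≤ 5 * ‖x‖ := by
  have hβ := hL.beta_pos
  have hγ₂ := hL.gamma_two_mem.1
  obtain ⟨ht, hm, hne, hrel, hc1, hc2, hacc⟩ := hx
  obtain ⟨hh0, hh3, hbacc, hb1, hb2⟩ := hb
  have ht' : 0 < t' := ht.trans_le htt
  have hs : 0 < Real.exp t - 1 := by linarith [Real.add_one_lt_exp ht.ne']
  have hspec := hL.newtonUpdate_spec hm ht'.le
  set s := Real.exp t - 1 with hsdef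
  set s' := Real.exp t' - 1 with hsdef'
  set x' := newtonUpdate L t' x with hx'
  set δ := x' - x with hδ
  have hxd : x + δ = x' := by rw [hδ]; abel
  have hss : s ≤ s' := by rw [hs']; nlinarith
  have hs'0 : 0 < s' := hs.trans_le hss
  have hxpos : 0 < ‖x‖ := norm_pos_iff.2 hne
  set G := ‖scaledGrad L s x‖ with hG
  have hG0 : 0 ≤ G := norm_nonneg _
  set G' := ‖scaledGrad L s' x‖ with hG'
  have hG'0 : 0 ≤ G' := norm_nonneg _
  have hG'le : G' ≤ (1 + h) * G + h * ‖x‖ := norm_scaledGrad_rescale_le hs hs' hh0 x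
  -- Used with e = 1 - γ₁ and e = -γ₂/2; a nonpositive exponent means that s^e does not increase
  -- with time. Numerically, 4/1000 + 1/442 < 7/1000.
  have key : ∀ e : ℝ, e ≤ 0 → β * s ^ e * G ≤ 1 / 1000 → h * (β * s ^ e * ‖x‖) ≤ 1 / 442 →
      β * s' ^ e * G' ≤ 7 / 1000 := by
    intro e he h1 h2
    have h3 : s' ^ e ≤ s ^ e := Real.rpow_le_rpow_of_nonpos hs hss he
    have h4 : 0 ≤ s ^ e := Real.rpow_nonneg hs.le _
    calc β * s' ^ e * G' ≤ β * s ^ e * ((1 + h) * G + h * ‖x‖) := by gcongr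
      _ = (1 + h) * (β * s ^ e * G) + h * (β * s ^ e * ‖x‖) := by ring
      _ ≤ (1 + h) * (1 / 1000) + 1 / 442 := by gcongr
      _ ≤ 7 / 1000 := by linarith
  have hk1 := key (1 - γ₁) (by linarith) hc1 hb1
  have hk2 := key (-(γ₂ / 2)) (by linarith) hc2 hb2
  obtain ⟨hm', hnew⟩ := hL.newton_step hm hs'0 hspec hk1 (hk2.trans (by norm_num))
  rw [hxd] at hm' hnew
  have hδle : ‖δ‖ ≤ G' := by
    have := (hL.norm_le_norm_hess_add hm hs'0.le δ).2
    rwa [hspec, norm_neg] at this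
  have hGx : (1 + h) * G ≤ ‖x‖ / 3 := by
    calc (1 + h) * G ≤ 4 * (‖x‖ / 12) := by
          apply mul_le_mul (by linarith) hrel hG0 (by norm_num)
      _ = ‖x‖ / 3 := by ring
  have hhx : h * ‖x‖ ≤ 3 * ‖x‖ := by gcongr
  have hup : ‖x'‖ ≤ 5 * ‖x‖ := by
    rw [← hxd]
    have := norm_add_le x δ
    linarith
  -- Here (sH + I)δ = hx - (1 + h)g at the new s, and (1 + h)‖g‖ ≤ ‖x‖/3.
  have hlow : 2 / 3 * ‖x‖ ≤ ‖x'‖ := by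
    have h1 := (hL.norm_le_norm_hess_add hm hs'0.le δ).1
    rw [hspec, LocalLipschitzHessian.scaledGrad_rescale hs.ne' x, hs',
      mul_div_cancel_right₀ _ hs.ne', add_sub_cancel_left, neg_sub] at h1
    have h2 := norm_sub_le_norm_add_of_sq_le hh0 (by linarith) h1
    rw [hxd] at h2
    linarith
  have hx'0 : 0 < ‖x'‖ := by linarith
  refine ⟨⟨ht', hm', norm_pos_iff.1 hx'0, ?_, ?_, ?_, ?_⟩, hup⟩
  · linarith
  · calc β * s' ^ (1 - γ₁) * ‖scaledGrad L s' x'‖ ≤ β * s' ^ (1 - γ₁) * (7 / 1000 * G') := by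
          have := Real.rpow_nonneg hs'0.le (1 - γ₁)
          gcongr
      _ = 7 / 1000 * (β * s' ^ (1 - γ₁) * G') := by ring
      _ ≤ 1 / 1000 := by linarith
  · calc β * s' ^ (-(γ₂ / 2)) * ‖scaledGrad L s' x'‖
        ≤ β * s' ^ (-(γ₂ / 2)) * (7 / 1000 * G') := by
          have := Real.rpow_nonneg hs'0.le (-(γ₂ / 2))
          gcongr
      _ = 7 / 1000 * (β * s' ^ (-(γ₂ / 2)) * G') := by ring
      _ ≤ 1 / 1000 := by linarith
  · have h1 : (1 + h) * G ≤ 4 * (A * Real.exp (t / 2) / 20) := by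
      apply mul_le_mul (by linarith) hacc hG0 (by norm_num)
    have h2 : A * Real.exp (t / 2) ≤ A * Real.exp (t' / 2) := by
      gcongr
    have h3 : 0 ≤ A * Real.exp (t / 2) := by positivity
    linarith

theorem le_log_one_add_iff {α B : ℝ} (hB : 0 ≤ B) : α ≤ Real.log (1 + B) ↔ Real.exp α - 1 ≤ B := by
  rw [Real.le_log_iff_exp_le (by linarith)]
  constructor <;> intro h <;> linarith

/-- The step size rule gives the step bounds. -/
theorem stepBounds_of_le_nextStep (hβ : 0 < β) {αmax α₁ α α' : ℝ} (hαmax : αmax ≤ 1 / 10)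
    (hα₁ : 0 < α₁) {x : Param p} (hx : x ≠ 0) (ht : 0 < t) (hαt : α ≤ t) (hα'0 : 0 ≤ α')
    (hα' : α' ≤ nextStep L β γ₁ γ₂ αmax α₁ α t x) :
    StepBounds β γ₁ γ₂ ((Real.exp α₁ - 1) * ‖gradient L 0‖) t
      ((Real.exp α' - 1) / (1 - Real.exp (-t))) x ∧
    Real.exp (t + α') - 1
      = (1 + (Real.exp α' - 1) / (1 - Real.exp (-t))) * (Real.exp t - 1) := by
  have hs1 : 0 < Real.exp α₁ - 1 := by linarith [Real.add_one_lt_exp hα₁.ne']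
  have hs : 0 < Real.exp t - 1 := by linarith [Real.add_one_lt_exp ht.ne']
  have hv : 0 < 1 - Real.exp (-t) := by
    have : Real.exp (-t) < 1 := Real.exp_lt_one_iff.2 (by linarith)
    linarith
  have hxpos : 0 < ‖x‖ := norm_pos_iff.2 hx
  have hsv : Real.exp t - 1 = Real.exp t * (1 - Real.exp (-t)) := by
    rw [mul_sub, ← Real.exp_add]; simp
  simp only [nextStep, le_min_iff] at hα'
  obtain ⟨⟨h1, h2⟩, h3, h4⟩ := hα'
  rw [le_log_one_add_iff (by positivity)] at h3
  rw [le_log_one_add_iff (by unfold constC₂; positivity)] at h4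
  have hnn : 0 ≤ Real.exp α' - 1 := by linarith [Real.one_le_exp hα'0]
  have h4' : (Real.exp α' - 1) * (442 * β * Real.exp t *
      max ((Real.exp t - 1) ^ (-γ₁)) ((Real.exp t - 1) ^ (-1 - γ₂ / 2)) * ‖x‖) ≤ 1 := by
    unfold constC₂ at h4
    rw [← one_div, le_div_iff₀ (by positivity)] at h4
    exact h4
  set h := (Real.exp α' - 1) / (1 - Real.exp (-t)) with hh
  have hhv : Real.exp α' - 1 = h * (1 - Real.exp (-t)) := by rw [hh]; field_simp
  -- The identity e^t(1 - e^{-t}) = e^t - 1 supplies the extra power, hence the exponent 1 + e.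
  have key : ∀ e : ℝ, (Real.exp t - 1) ^ e ≤
      max ((Real.exp t - 1) ^ (-γ₁)) ((Real.exp t - 1) ^ (-1 - γ₂ / 2)) →
      h * (β * (Real.exp t - 1) ^ (1 + e) * ‖x‖) ≤ 1 / 442 := by
    intro e he
    rw [Real.rpow_add hs, Real.rpow_one]
    have : (Real.exp α' - 1) * (442 * β * Real.exp t * (Real.exp t - 1) ^ e * ‖x‖) ≤ 1 := by
      refine le_trans ?_ h4'
      gcongr
    rw [hhv] at this
    have e2 : h * (β * ((Real.exp t - 1) * (Real.exp t - 1) ^ e) * ‖x‖) * 442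
      = h * (1 - Real.exp (-t)) * (442 * β * Real.exp t * (Real.exp t - 1) ^ e * ‖x‖) := by
      nth_rewrite 1 [hsv]; ring
    linarith
  refine ⟨⟨by positivity, ?_, ?_, ?_, ?_⟩, ?_⟩
  · rw [hh, div_le_iff₀ hv]
    exact exp_sub_one_le_of_le_two_mul (h1.trans hαmax) h2 hαt ht
  · rw [hhv, le_div_iff₀ hxpos] at h3
    have : h * ‖x‖ * (1 - Real.exp (-t)) ≤
        (Real.exp α₁ - 1) * ‖gradient L 0‖ * Real.exp (t / 2) * (1 - Real.exp (-t)) := by linarith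
    exact le_of_mul_le_mul_right this hv
  · simpa [sub_eq_add_neg] using key (-γ₁) (le_max_left _ _)
  · have := key (-1 - γ₂ / 2) (le_max_right _ _)
    rwa [show 1 + (-1 - γ₂ / 2) = -(γ₂ / 2) by ring] at this
  · rw [add_mul, one_mul]
    have : h * (Real.exp t - 1) = Real.exp t * (Real.exp α' - 1) := by rw [hhv, hsv]; ring
    rw [this, Real.exp_add]; ring

theorem nextStep_pos (hβ : 0 < β) (hgrad : gradient L 0 ≠ 0) {αmax α₁ α : ℝ} (hαmax : 0 < αmax)
    (hα₁ : 0 < α₁) {x : Param p} (hx : x ≠ 0) (ht : 0 < t) (hα : 0 < α) :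
    0 < nextStep L β γ₁ γ₂ αmax α₁ α t x := by
  have hs1 : 0 < Real.exp α₁ - 1 := by linarith [Real.add_one_lt_exp hα₁.ne']
  have hs : 0 < Real.exp t - 1 := by linarith [Real.add_one_lt_exp ht.ne']
  have hv : 0 < 1 - Real.exp (-t) := by
    have : Real.exp (-t) < 1 := Real.exp_lt_one_iff.2 (by linarith)
    linarith
  have hxpos : 0 < ‖x‖ := norm_pos_iff.2 hx
  have hg : 0 < ‖gradient L 0‖ := norm_pos_iff.2 hgrad
  have hmax : 0 < max ((Real.exp t - 1) ^ (-γ₁)) ((Real.exp t - 1) ^ (-1 - γ₂ / 2)) :=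
    lt_max_of_lt_left (Real.rpow_pos_of_pos hs _)
  simp only [nextStep, lt_min_iff]
  refine ⟨⟨hαmax, by linarith⟩, Real.log_pos ?_, Real.log_pos ?_⟩
  · rw [lt_add_iff_pos_right]; positivity
  · rw [lt_add_iff_pos_right]; unfold constC₂; positivity

end

/-! ### The first Newton step -/

section

variable {L : Param p → ℝ} {D : Set (Param p)} {β γ₁ γ₂ αmax ε α₁ : ℝ}

namespace LocalLipschitzHessian

theorem max_const_pos (hL : LocalLipschitzHessian L D β γ₁ γ₂) (hgrad : gradient L 0 ≠ 0) (α : ℝ) :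
    0 < max (constC₁ L γ₁ α) (Real.sqrt 2 * constC₂) * β * ‖gradient L 0‖ := by
  have hβ := hL.beta_pos
  have hg : 0 < ‖gradient L 0‖ := norm_pos_iff.2 hgrad
  have : 0 < max (constC₁ L γ₁ α) (Real.sqrt 2 * constC₂) :=
    lt_max_of_lt_right (by unfold constC₂; positivity)
  positivity

theorem firstStepBound_pos (hL : LocalLipschitzHessian L D β γ₁ γ₂) (hgrad : gradient L 0 ≠ 0)
    (hαmax : 0 < αmax) (hε : 0 < ε) (α : ℝ) : 0 < firstStepBound L β γ₁ γ₂ αmax ε α := by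
  have hg : 0 < ‖gradient L 0‖ := norm_pos_iff.2 hgrad
  have hX := Real.rpow_pos_of_pos (hL.max_const_pos hgrad α) (-(1 / min (2 - γ₁) (1 - γ₂ / 2)))
  simp only [firstStepBound, lt_min_iff]
  refine ⟨hαmax, Real.log_pos ?_, Real.log_pos ?_⟩
  · rw [lt_add_iff_pos_right]; have := Real.sqrt_pos.2 hε; positivity
  · rw [lt_add_iff_pos_right]; exact hX

/-- The consequences of the first step size rule used below. -/
theorem firstStep_bounds (hL : LocalLipschitzHessian L D β γ₁ γ₂) (hgrad : gradient L 0 ≠ 0)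
    (hγ₁ : 1 ≤ γ₁) (hαmax : αmax ≤ 1 / 10) (hα₁ : 0 < α₁)
    (hle : α₁ ≤ firstStepBound L β γ₁ γ₂ αmax ε α₁) :
    Real.exp α₁ - 1 ≤ 1 / 9 ∧
    (Real.exp α₁ - 1) * ‖gradient L 0‖ ≤ Real.sqrt ε ∧
    (Real.exp α₁ - 1) * constC₁ L γ₁ α₁ * (β * ‖gradient L 0‖) ≤ 1 ∧
    (Real.exp α₁ - 1) ^ (2 - γ₁) * (β * ‖gradient L 0‖) ≤ 1 / 600 ∧
    (Real.exp α₁ - 1) ^ (1 - γ₂ / 2) * (β * ‖gradient L 0‖) ≤ 1 / 600 := by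
  have hβ := hL.beta_pos
  have hg : 0 < ‖gradient L 0‖ := norm_pos_iff.2 hgrad
  have hX := hL.max_const_pos hgrad α₁
  simp only [firstStepBound, le_min_iff] at hle
  obtain ⟨h1, h2, h3⟩ := hle
  have hs0 : 0 < Real.exp α₁ - 1 := by linarith [Real.add_one_lt_exp hα₁.ne']
  rw [le_log_one_add_iff (by positivity), le_div_iff₀ hg] at h2
  rw [le_log_one_add_iff (Real.rpow_nonneg hX.le _)] at h3
  have hs9 : Real.exp α₁ - 1 ≤ 1 / 9 := by
    have h4 := Real.one_sub_le_exp_neg α₁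
    rw [Real.exp_neg] at h4
    have h5 : Real.exp α₁ * (Real.exp α₁)⁻¹ = 1 := mul_inv_cancel₀ (Real.exp_pos _).ne'
    nlinarith [Real.exp_pos α₁]
  set s := Real.exp α₁ - 1 with hs
  set m := min (2 - γ₁) (1 - γ₂ / 2) with hm
  have hm0 : 0 < m := lt_min (by linarith [hL.gamma_one_mem.2]) (by linarith [hL.gamma_two_mem.2])
  have hm1 : m ≤ 1 := (min_le_left _ _).trans (by linarith)
  -- The exponent -1/m in the step bound is inverted by raising to the power m.
  have hsm : s ^ m * (max (constC₁ L γ₁ α₁) (Real.sqrt 2 * constC₂) * β * ‖gradient L 0‖) ≤ 1 := by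
    have h4 : s ^ m ≤ (max (constC₁ L γ₁ α₁) (Real.sqrt 2 * constC₂) * β * ‖gradient L 0‖)⁻¹ := by
      refine (Real.rpow_le_rpow hs0.le h3 hm0.le).trans (le_of_eq ?_)
      rw [← Real.rpow_mul hX.le, ← Real.rpow_neg_one]
      congr 1; field_simp
    calc _ ≤ _ := mul_le_mul_of_nonneg_right h4 hX.le
      _ = 1 := inv_mul_cancel₀ hX.ne'
  have hkey : ∀ e : ℝ, m ≤ e → s ^ e * (β * ‖gradient L 0‖) ≤ 1 / 600 := by
    intro e he
    have h4 : s ^ e ≤ s ^ m := Real.rpow_le_rpow_of_exponent_ge hs0 (by linarith) he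
    -- √2 · 442 > 1.4 · 442 > 600.
    have h5 : (600 : ℝ) ≤ max (constC₁ L γ₁ α₁) (Real.sqrt 2 * constC₂) := by
      refine le_max_of_le_right ?_
      have : (1.4 : ℝ) ≤ Real.sqrt 2 := Real.le_sqrt_of_sq_le (by norm_num)
      unfold constC₂; linarith
    have h6 : 0 < s ^ m := Real.rpow_pos_of_pos hs0 _
    have h7 : s ^ m * (600 * β * ‖gradient L 0‖) ≤ 1 := le_trans (by gcongr) hsm
    have h8 : s ^ e * (β * ‖gradient L 0‖) ≤ s ^ m * (β * ‖gradient L 0‖) := by gcongr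
    linarith
  refine ⟨hs9, h2, ?_, hkey _ (min_le_left _ _), hkey _ (min_le_right _ _)⟩
  have h4 : s ≤ s ^ m := by
    conv_lhs => rw [← Real.rpow_one s]
    exact Real.rpow_le_rpow_of_exponent_ge hs0 (by linarith) hm1
  have h5 := Real.rpow_pos_of_pos hs0 m
  calc s * constC₁ L γ₁ α₁ * (β * ‖gradient L 0‖)
      ≤ s * max (constC₁ L γ₁ α₁) (Real.sqrt 2 * constC₂) * (β * ‖gradient L 0‖) := by
        gcongr; exact le_max_left _ _
    _ = s * (max (constC₁ L γ₁ α₁) (Real.sqrt 2 * constC₂) * β * ‖gradient L 0‖) := by ring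
    _ ≤ s ^ m * (max (constC₁ L γ₁ α₁) (Real.sqrt 2 * constC₂) * β * ‖gradient L 0‖) := by
        gcongr
    _ ≤ 1 := hsm

/-- The power of the Hessian at `0` is dominated by an affine function whose size is controlled by
the constant `C₁`. -/
theorem exists_affine_bound (hL : LocalLipschitzHessian L D β γ₁ γ₂) (h0 : (0 : Param p) ∈ D)
    (hγ₁ : 1 ≤ γ₁) (hα₁ : 0 < α₁) (hs9 : Real.exp α₁ - 1 ≤ 1 / 9) :
    ∃ C : ℝ, 0 ≤ C ∧ (∀ y ∈ spectrum ℝ (hess L 0), y ^ γ₁ ≤ C * (1 + (Real.exp α₁ - 1) * y)) ∧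
      (Real.exp α₁ - 1) * C ≤ constC₁ L γ₁ α₁ / 12 := by
  have hs0 : 0 < Real.exp α₁ - 1 := by linarith [Real.add_one_lt_exp hα₁.ne']
  have hnn : ∀ y ∈ spectrum ℝ (hess L 0), 0 ≤ y := fun y hy =>
    spectrum_nonneg_of_inner_nonneg (hL.isSelfAdjoint_hess h0) (hL.inner_hess_nonneg h0) hy
  have hbdd : BddAbove (spectrum ℝ (hess L 0)) := (spectrum.isCompact _).bddAbove
  set s := Real.exp α₁ - 1 with hs
  rcases hγ₁.eq_or_lt with h1 | h1
  · refine ⟨1 / s, by positivity, fun y hy => ?_, ?_⟩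
    · rw [← h1, Real.rpow_one, mul_add, ← mul_assoc, one_div, inv_mul_cancel₀ hs0.ne']
      have : 0 < s⁻¹ := by positivity
      linarith
    · rw [constC₁, if_pos h1.symm.le, mul_one_div_cancel hs0.ne']; norm_num
  · set ν := sSup (spectrum ℝ (hess L 0)) with hν
    have hν0 : 0 ≤ ν := Real.sSup_nonneg hnn
    -- Two dominations of y^γ₁: by ν^{γ₁-1}y, absorbed in the linear term, and by the constant ν^γ₁.
    -- They match the two entries of the minimum in C₁.
    refine ⟨min (ν ^ (γ₁ - 1) / s) (ν ^ γ₁),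
      le_min (div_nonneg (Real.rpow_nonneg hν0 _) hs0.le) (Real.rpow_nonneg hν0 _),
      fun y hy => ?_, ?_⟩
    · have hy0 := hnn y hy
      have hyν : y ≤ ν := le_csSup hbdd hy
      have hp : 0 ≤ 1 + s * y := by positivity
      rw [min_mul_of_nonneg _ _ hp]
      refine le_min ?_ ?_
      · have h2 : y ^ γ₁ = y * y ^ (γ₁ - 1) := by
          conv_rhs => enter [1]; rw [← Real.rpow_one y]
          rw [← Real.rpow_add_of_nonneg hy0 (by norm_num) (by linarith)]
          congr 1; ring
        have h3 : y ^ (γ₁ - 1) ≤ ν ^ (γ₁ - 1) := Real.rpow_le_rpow hy0 hyν (by linarith)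
        have h4 : 0 ≤ ν ^ (γ₁ - 1) := Real.rpow_nonneg hν0 _
        have h5 : ν ^ (γ₁ - 1) / s * (1 + s * y)
          = ν ^ (γ₁ - 1) / s + y * ν ^ (γ₁ - 1) := by field_simp
        rw [h5, h2]
        have : y * y ^ (γ₁ - 1) ≤ y * ν ^ (γ₁ - 1) := by gcongr
        have : 0 ≤ ν ^ (γ₁ - 1) / s := by positivity
        linarith
      · have h3 : y ^ γ₁ ≤ ν ^ γ₁ := Real.rpow_le_rpow hy0 hyν (by linarith)
        have h4 : 0 ≤ ν ^ γ₁ := Real.rpow_nonneg hν0 _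
        have : 0 ≤ ν ^ γ₁ * (s * y) := by positivity
        linarith
    · rw [constC₁, if_neg (not_le.2 h1), ← hν]
      set a := ν ^ (γ₁ - 1) with ha
      set b := ν ^ γ₁ with hb
      have ha0 : 0 ≤ a := Real.rpow_nonneg hν0 _
      have hb0 : 0 ≤ b := Real.rpow_nonneg hν0 _
      -- e^{-α₁}(1 - e^{-α₁}) = s/(1 + s)², and s ≤ 1/9. The loss 5/4 is the ratio 15/12 available
      -- in C₁.
      have hw : 4 / 5 * s ≤ Real.exp (-α₁) * (1 - Real.exp (-α₁)) := by
        have he : Real.exp α₁ = s + 1 := by rw [hs]; ring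
        rw [Real.exp_neg, he]
        have : (s + 1)⁻¹ * (1 - (s + 1)⁻¹) = s / (s + 1) ^ 2 := by field_simp; ring
        rw [this, le_div_iff₀ (by positivity)]
        have h9 : (s + 1) ^ 2 ≤ 5 / 4 := by nlinarith
        have := mul_le_mul_of_nonneg_left h9 hs0.le
        linarith
      rw [mul_min_of_nonneg _ _ hs0.le, mul_div_cancel₀ _ hs0.ne']
      have h2 : 15 * min a (b * (Real.exp (-α₁) * (1 - Real.exp (-α₁)))) / 12
        = min (5 / 4 * a) (5 / 4 * (b * (Real.exp (-α₁) * (1 - Real.exp (-α₁))))) := by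
        rw [← mul_min_of_nonneg _ _ (by norm_num : (0 : ℝ) ≤ 5 / 4)]; ring
      rw [h2]
      apply min_le_min
      · linarith
      · have := mul_le_mul_of_nonneg_left hw hb0
        linarith

/-- The first iterate. -/
theorem tracks_first (hL : LocalLipschitzHessian L D β γ₁ γ₂) (h0 : (0 : Param p) ∈ D)
    (hgrad : gradient L 0 ≠ 0)
    (hγ₁ : 1 ≤ γ₁) (hαmax : αmax ≤ 1 / 10) (hα₁ : 0 < α₁)
    (hle : α₁ ≤ firstStepBound L β γ₁ γ₂ αmax ε α₁) :
    Tracks L D β γ₁ γ₂ ((Real.exp α₁ - 1) * ‖gradient L 0‖) α₁ (newtonUpdate L α₁ 0) ∧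
      ‖newtonUpdate L α₁ 0‖ ≤ (Real.exp α₁ - 1) * ‖gradient L 0‖ := by
  have hβ := hL.beta_pos
  have hg : 0 < ‖gradient L 0‖ := norm_pos_iff.2 hgrad
  obtain ⟨hs9, -, hC₁, hk1, hk2⟩ := hL.firstStep_bounds hgrad hγ₁ hαmax hα₁ hle
  obtain ⟨C, hC0, hC, hCs⟩ := hL.exists_affine_bound h0 hγ₁ hα₁ hs9
  have hspec := hL.newtonUpdate_spec h0 hα₁.le
  rw [sub_zero] at hspec
  have hs0 : 0 < Real.exp α₁ - 1 := by linarith [Real.add_one_lt_exp hα₁.ne']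
  set s := Real.exp α₁ - 1 with hs
  set δ := newtonUpdate L α₁ 0 with hδ
  have hG0 : scaledGrad L s 0 = s • gradient L 0 := by simp [scaledGrad]
  have hG0n : ‖scaledGrad L s 0‖ = s * ‖gradient L 0‖ := by
    rw [hG0, norm_smul, Real.norm_of_nonneg hs0.le]
  have hkey : ∀ e : ℝ, s ^ (1 + e) * (β * ‖gradient L 0‖) ≤ 1 / 600 →
      β * s ^ e * ‖scaledGrad L s 0‖ ≤ 1 / 600 := by
    intro e h
    rw [Real.rpow_add hs0, Real.rpow_one] at h
    rw [hG0n]; linarith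
  have hc1 := hkey (1 - γ₁) (by convert hk1 using 3; ring)
  have hc2 := hkey (-(γ₂ / 2)) (by convert hk2 using 3; ring)
  obtain ⟨hm, hnew⟩ := hL.newton_step h0 hs0 hspec hc1 (hc2.trans (by norm_num))
  rw [zero_add] at hm hnew
  have hδle : ‖δ‖ ≤ s * ‖gradient L 0‖ := by
    have := (hL.norm_le_norm_hess_add h0 hs0.le δ).2
    rwa [hspec, norm_neg, hG0n] at this
  -- An affine bound keeps one factor ‖δ‖, where the quadratic one would give only the squared
  -- residual. As the iterate is δ itself, this is what makes the error relative.
  have hcond : ⟪δ, opPow (hess L 0) γ₁ δ⟫ ≤ C * (‖δ‖ * (s * ‖gradient L 0‖)) := by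
    have h1 := hL.inner_opPow_hess_le_affine h0 (γ := γ₁) (C := C) (s := s) hC δ
    refine h1.trans (mul_le_mul_of_nonneg_left ?_ hC0)
    rw [hspec, ← hG0n, ← norm_neg (scaledGrad L s 0)]
    exact real_inner_le_norm _ _
  have hδne : δ ≠ 0 := by
    intro h
    rw [h, map_zero, smul_zero, add_zero, eq_comm, neg_eq_zero, hG0, smul_eq_zero] at hspec
    exact hspec.elim hs0.ne' hgrad
  have hnorm := norm_nonneg (scaledGrad L s 0)
  refine ⟨⟨hα₁, hm, hδne, ?_, ?_, ?_, ?_⟩, hδle⟩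
  · have hγ₂cond := hL.inner_opPow_le_inv_sq h0 hs0 hspec (hc2.trans (by norm_num))
    have h2 := (hL.gradient_add_sub_le h0 hs0 hspec hγ₂cond).2
    rw [zero_add] at h2
    calc ‖scaledGrad L s δ‖ ≤ s * (β * ⟪δ, opPow (hess L 0) γ₁ δ⟫) := h2
      _ ≤ s * (β * (C * (‖δ‖ * (s * ‖gradient L 0‖)))) := by gcongr
      _ = (s * C) * (s * (β * ‖gradient L 0‖) * ‖δ‖) := by ring
      _ ≤ (constC₁ L γ₁ α₁ / 12) * (s * (β * ‖gradient L 0‖) * ‖δ‖) := by gcongr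
      _ = (s * constC₁ L γ₁ α₁ * (β * ‖gradient L 0‖)) * (‖δ‖ / 12) := by ring
      _ ≤ 1 * (‖δ‖ / 12) := by gcongr
      _ = ‖δ‖ / 12 := one_mul _
  · calc β * s ^ (1 - γ₁) * ‖scaledGrad L s δ‖
        ≤ β * s ^ (1 - γ₁) * (1 / 600 * ‖scaledGrad L s 0‖) := by
          have := Real.rpow_nonneg hs0.le (1 - γ₁)
          gcongr
      _ = 1 / 600 * (β * s ^ (1 - γ₁) * ‖scaledGrad L s 0‖) := by ring
      _ ≤ 1 / 1000 := by linarith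
  · calc β * s ^ (-(γ₂ / 2)) * ‖scaledGrad L s δ‖
        ≤ β * s ^ (-(γ₂ / 2)) * (1 / 600 * ‖scaledGrad L s 0‖) := by
          have := Real.rpow_nonneg hs0.le (-(γ₂ / 2))
          gcongr
      _ = 1 / 600 * (β * s ^ (-(γ₂ / 2)) * ‖scaledGrad L s 0‖) := by ring
      _ ≤ 1 / 1000 := by linarith
  · have h1 : 1 ≤ Real.exp (α₁ / 2) := Real.one_le_exp (by linarith)
    have h2 : s * ‖gradient L 0‖ * 1 ≤ s * ‖gradient L 0‖ * Real.exp (α₁ / 2) := by gcongr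
    rw [hG0n] at hnew hnorm
    linarith

end LocalLipschitzHessian

end

/-! ### Lower bounds on step sizes and the step count -/

theorem exp_mul_one_sub_exp_neg (t : ℝ) : Real.exp t * (1 - Real.exp (-t)) = Real.exp t - 1 := by
  rw [mul_sub, ← Real.exp_add]; simp

theorem exp_sub_one_pos {t : ℝ} (ht : 0 < t) : 0 < Real.exp t - 1 := by
  linarith [Real.add_one_lt_exp ht.ne']

theorem exp_sub_one_le_two_mul {x : ℝ} (h0 : 0 ≤ x) (h1 : x ≤ 1) : Real.exp x - 1 ≤ 2 * x := by
  have h := Real.abs_exp_sub_one_le (x := x) (by rwa [abs_of_nonneg h0])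
  rw [abs_of_nonneg h0] at h
  exact (le_abs_self _).trans h

section

variable {L : Param p → ℝ} {D : Set (Param p)} {β γ₁ γ₂ αmax ε α₁ A t : ℝ}

/-- The iterate is bounded by a multiple of the norm of a minimizer further along the path. -/
theorem Tracks.norm_le_of_isMinOn (hL : LocalLipschitzHessian L D β γ₁ γ₂) {x ϑ : Param p}
    (hx : Tracks L D β γ₁ γ₂ A t x) {T : ℝ≥0∞} (hT : ENNReal.ofReal t ≤ T) (hϑ : ϑ ∈ D)
    (hmin : IsMinOn (objective L T) D ϑ) : ‖x‖ ≤ 2 * ‖ϑ‖ := by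
  by_contra hcon
  push Not at hcon
  have hs := exp_sub_one_pos hx.time_pos
  have hu0 : 0 ≤ expNeg T := by unfold expNeg; split_ifs <;> positivity
  have hu1 : expNeg T ≤ Real.exp (-t) := by
    unfold expNeg
    split_ifs with h
    · positivity
    · apply Real.exp_le_exp.2
      have := ENNReal.toReal_mono h hT
      rw [ENNReal.toReal_ofReal hx.time_pos.le] at this
      linarith
  have hu2 : Real.exp (-t) < 1 := Real.exp_lt_one_iff.2 (by linarith [hx.time_pos])
  have h1 : objective L T ϑ ≤ objective L T x := hmin hx.mem
  unfold objective at h1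
  have h2 : 0 ≤ ‖x‖ ^ 2 - ‖ϑ‖ ^ 2 := by nlinarith [norm_nonneg ϑ]
  -- ϑ has the smaller norm, so it still beats x at the earlier time, where the norm carries more
  -- weight.
  have h3 : (Real.exp t - 1) * L ϑ + ‖ϑ‖ ^ 2 / 2 ≤ (Real.exp t - 1) * L x + ‖x‖ ^ 2 / 2 := by
    rcases le_total (L ϑ) (L x) with h | h
    · nlinarith
    · have h4 : (1 - Real.exp (-t)) * (L ϑ - L x) ≤ (1 - expNeg T) * (L ϑ - L x) := by
        apply mul_le_mul_of_nonneg_right _ (by linarith); linarith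
      have h5 : expNeg T * (‖x‖ ^ 2 - ‖ϑ‖ ^ 2) ≤ Real.exp (-t) * (‖x‖ ^ 2 - ‖ϑ‖ ^ 2) := by gcongr
      have h6 : (1 - Real.exp (-t)) * (L ϑ - L x) ≤ Real.exp (-t) / 2 * (‖x‖ ^ 2 - ‖ϑ‖ ^ 2) := by
        linarith
      have h7 := mul_le_mul_of_nonneg_left h6 (Real.exp_pos t).le
      rw [← mul_assoc, exp_mul_one_sub_exp_neg, ← mul_assoc, ← mul_div_assoc, ← Real.exp_add,
        add_neg_cancel, Real.exp_zero] at h7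
      linarith
  have h4 := hL.scaled_first_order hx.mem hϑ hs.le
  -- Strong convexity now forces ‖ϑ - x‖ ≤ 2‖g‖ ≤ ‖x‖/6, against ‖ϑ - x‖ > ‖x‖/2.
  have h5 := neg_le_of_abs_le (abs_real_inner_le_norm (scaledGrad L (Real.exp t - 1) x) (ϑ - x))
  have h6 := hx.relative
  have h7 : ‖x‖ - ‖ϑ‖ ≤ ‖ϑ - x‖ := by rw [norm_sub_rev]; exact norm_sub_norm_le _ _
  have h8 : ‖scaledGrad L (Real.exp t - 1) x‖ * ‖ϑ - x‖ ≤ ‖x‖ / 12 * ‖ϑ - x‖ := by gcongr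
  nlinarith [norm_nonneg (ϑ - x), norm_nonneg ϑ]

theorem Tracks.norm_le_mul (hL : LocalLipschitzHessian L D β γ₁ γ₂) (h0 : (0 : Param p) ∈ D)
    {x : Param p} (hx : Tracks L D β γ₁ γ₂ A t x) :
    ‖x‖ ≤ 2 * ((Real.exp t - 1) * ‖gradient L 0‖) := by
  have hs := exp_sub_one_pos hx.time_pos
  have h1 := hL.norm_sub_le_scaledGrad h0 hx.mem hs.le
  have h2 := norm_sub_le (scaledGrad L (Real.exp t - 1) x) (scaledGrad L (Real.exp t - 1) 0)
  have h3 : ‖scaledGrad L (Real.exp t - 1) 0‖ = (Real.exp t - 1) * ‖gradient L 0‖ := by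
    simp [scaledGrad, norm_smul, abs_of_pos hs]
  rw [sub_zero] at h1
  have := hx.relative
  have : 0 ≤ (Real.exp t - 1) * ‖gradient L 0‖ := by positivity
  linarith

/-- Average the bounds by ‖ϑ‖ and by (e^t - 1)‖∇L(0)‖ with weights 1 - e^{-t} and e^{-t}. The factor
1 - e^{-t} keeps the step size bounds uniform for small t. -/
theorem Tracks.norm_le_mul_one_sub_exp_neg (hL : LocalLipschitzHessian L D β γ₁ γ₂)
    (h0 : (0 : Param p) ∈ D) {x ϑ : Param p}
    (hx : Tracks L D β γ₁ γ₂ A t x) {T : ℝ≥0∞} (hT : ENNReal.ofReal t ≤ T) (hϑ : ϑ ∈ D)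
    (hmin : IsMinOn (objective L T) D ϑ) :
    ‖x‖ ≤ 2 * (‖ϑ‖ + ‖gradient L 0‖) * (1 - Real.exp (-t)) := by
  have h1 := hx.norm_le_of_isMinOn hL hT hϑ hmin
  have h2 := hx.norm_le_mul hL h0
  have hv : 0 ≤ 1 - Real.exp (-t) := by
    have : Real.exp (-t) < 1 := Real.exp_lt_one_iff.2 (by linarith [hx.time_pos])
    linarith
  have h3 := mul_le_mul_of_nonneg_right h1 hv
  have h4 := mul_le_mul_of_nonneg_left h2 (Real.exp_pos (-t)).le
  have h5 : Real.exp (-t) * (Real.exp t - 1) = 1 - Real.exp (-t) := by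
    rw [mul_sub, ← Real.exp_add]; simp
  have h6 : Real.exp (-t) * (2 * ((Real.exp t - 1) * ‖gradient L 0‖))
      = 2 * ‖gradient L 0‖ * (1 - Real.exp (-t)) := by rw [← h5]; ring
  linarith

/-- Before termination, the step sizes grow like `e^{t/2}`. -/
theorem Tracks.le_nextStep (hL : LocalLipschitzHessian L D β γ₁ γ₂)
    (hgrad : gradient L 0 ≠ 0) (hγ₁ : 1 ≤ γ₁) (hα₁ : 0 < α₁) (ht : α₁ ≤ t)
    {x : Param p} {S Q κ α : ℝ} (hS : 0 < S) (hx0 : x ≠ 0)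
    (hx : ‖x‖ ≤ S * (1 - Real.exp (-t)))
    (hQ : (Real.exp α₁ - 1) * Real.exp (t / 2) ≤ Q) (hQ1 : 1 ≤ Q) (hκ : 0 < κ)
    (hκ1 : κ * Q ≤ 1) (hκ2 : κ * Q ≤ αmax) (hκ3 : κ * (2 * S) ≤ ‖gradient L 0‖)
    (hκ4 : κ * (1768 * β * S * Q) ≤ 1)
    (hα : κ * ((Real.exp α₁ - 1) * Real.exp (t / 2)) ≤ 2 * α) :
    κ * ((Real.exp α₁ - 1) * Real.exp (t / 2)) ≤
      nextStep L β γ₁ γ₂ αmax α₁ α t x := by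
  have hβ := hL.beta_pos
  have hg : 0 < ‖gradient L 0‖ := norm_pos_iff.2 hgrad
  have hxp : 0 < ‖x‖ := norm_pos_iff.2 hx0
  have hs1 := exp_sub_one_pos hα₁
  have ht0 : 0 < t := hα₁.trans_le ht
  have hs := exp_sub_one_pos ht0
  have hss : Real.exp α₁ - 1 ≤ Real.exp t - 1 := by linarith [Real.exp_le_exp.2 ht]
  have hv : 0 < 1 - Real.exp (-t) := by
    have : Real.exp (-t) < 1 := Real.exp_lt_one_iff.2 (by linarith)
    linarith
  have hexs : Real.exp t * ‖x‖ ≤ S * (Real.exp t - 1) := by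
    rw [← exp_mul_one_sub_exp_neg]
    have := mul_le_mul_of_nonneg_left hx (Real.exp_pos t).le
    linarith
  have hhalf : Real.exp (t / 2) ≤ Real.exp t := Real.exp_le_exp.2 (by linarith)
  have hhalf0 := Real.exp_pos (t / 2)
  set s₁ := Real.exp α₁ - 1 with hs₁
  set s := Real.exp t - 1 with hsdef
  set ψ := s₁ * Real.exp (t / 2) with hψ
  have hψ0 : 0 < ψ := by positivity
  have hκψ : κ * ψ ≤ κ * Q := by gcongr
  have hexp := exp_sub_one_le_two_mul (x := κ * ψ) (by positivity) (by linarith)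
  -- For s ≥ 1 use ψ ≤ Q. For s ≤ 1 the singularity of s^e is at most s⁻¹ and is cancelled by ψ ≤
  -- 2s, as s₁ ≤ s and e^{t/2} ≤ 2.
  have hpow : ∀ e : ℝ, -1 ≤ e → e ≤ 0 → ψ * s ^ e ≤ 2 * Q := by
    intro e he1 he0
    rcases le_total 1 s with h | h
    · have h1 : s ^ e ≤ 1 := Real.rpow_le_one_of_one_le_of_nonpos h he0
      have h2 : 0 ≤ s ^ e := Real.rpow_nonneg hs.le _
      nlinarith
    · have h1 : s ^ e ≤ s ^ (-1 : ℝ) := Real.rpow_le_rpow_of_exponent_ge hs h he1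
      rw [Real.rpow_neg_one] at h1
      have h2 : ψ ≤ s * 2 := by
        apply mul_le_mul hss _ hhalf0.le hs.le
        linarith
      calc ψ * s ^ e ≤ (s * 2) * s⁻¹ := by
            have := Real.rpow_nonneg hs.le e
            gcongr
        _ = 2 := by field_simp
        _ ≤ 2 * Q := by linarith
  simp only [nextStep, le_min_iff]
  refine ⟨⟨by linarith, hα⟩, ?_, ?_⟩
  · rw [le_log_one_add_iff (by positivity)]
    refine hexp.trans ?_
    rw [le_div_iff₀ hxp, ← hs₁]
    calc 2 * (κ * ψ) * ‖x‖ ≤ 2 * (κ * ψ) * (S * (1 - Real.exp (-t))) := by gcongr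
      _ = (κ * (2 * S)) * (ψ * (1 - Real.exp (-t))) := by ring
      _ ≤ ‖gradient L 0‖ * (ψ * (1 - Real.exp (-t))) := by gcongr
      _ = _ := by rw [hψ]; ring
  · have hmax : 0 < max (s ^ (-γ₁)) (s ^ (-1 - γ₂ / 2)) :=
      lt_max_of_lt_left (Real.rpow_pos_of_pos hs _)
    rw [le_log_one_add_iff (by unfold constC₂; positivity)]
    refine hexp.trans ?_
    rw [← one_div, le_div_iff₀ (by unfold constC₂; positivity)]
    have hm : ψ * (s * max (s ^ (-γ₁)) (s ^ (-1 - γ₂ / 2))) ≤ 2 * Q := by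
      rw [mul_max_of_nonneg _ _ hs.le, mul_max_of_nonneg _ _ hψ0.le]
      apply max_le
      · have := hpow (1 - γ₁) (by linarith [hL.gamma_one_mem.2]) (by linarith)
        rwa [sub_eq_add_neg, Real.rpow_add hs, Real.rpow_one] at this
      · have := hpow (1 + (-1 - γ₂ / 2)) (by linarith [hL.gamma_two_mem.2])
          (by linarith [hL.gamma_two_mem.1])
        rwa [Real.rpow_add hs, Real.rpow_one] at this
    unfold constC₂
    set m := max (s ^ (-γ₁)) (s ^ (-1 - γ₂ / 2)) with hmdef
    calc 2 * (κ * ψ) * (442 * β * Real.exp t * m * ‖x‖)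
        = 884 * κ * β * (ψ * m) * (Real.exp t * ‖x‖) := by ring
      _ ≤ 884 * κ * β * (ψ * m) * (S * s) := by gcongr
      _ = 884 * κ * β * S * (ψ * (s * m)) := by ring
      _ ≤ 884 * κ * β * S * (2 * Q) := by gcongr
      _ = κ * (1768 * β * S * Q) := by ring
      _ ≤ 1 := hκ4

/-- All iterates track the solution path. -/
theorem run_tracks (hL : LocalLipschitzHessian L D β γ₁ γ₂) (h0 : (0 : Param p) ∈ D)
    (hgrad : gradient L 0 ≠ 0) (hγ₁ : 1 ≤ γ₁) (hαmax0 : 0 < αmax) (hαmax : αmax ≤ 1 / 10)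
    (hα₁ : 0 < α₁) (hle : α₁ ≤ firstStepBound L β γ₁ γ₂ αmax ε α₁) (k : ℕ) :
    Tracks L D β γ₁ γ₂ ((Real.exp α₁ - 1) * ‖gradient L 0‖)
      (run L β γ₁ γ₂ αmax α₁ (k + 1)).time (run L β γ₁ γ₂ αmax α₁ (k + 1)).iterate ∧
    0 < (run L β γ₁ γ₂ αmax α₁ (k + 1)).stepSize ∧
    (run L β γ₁ γ₂ αmax α₁ (k + 1)).stepSize ≤ (run L β γ₁ γ₂ αmax α₁ (k + 1)).time ∧
    (run L β γ₁ γ₂ αmax α₁ (k + 1)).stepSize ≤ 1 / 10 ∧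
    α₁ ≤ (run L β γ₁ γ₂ αmax α₁ (k + 1)).time := by
  have hβ := hL.beta_pos
  induction k with
  | zero =>
    have h1 : α₁ ≤ αmax := hle.trans (min_le_left _ _)
    have := (hL.tracks_first h0 hgrad hγ₁ hαmax hα₁ hle).1
    simp only [run, if_true, zero_add]
    exact ⟨this, hα₁, le_rfl, by linarith, le_rfl⟩
  | succ k ih =>
    rw [run]
    simp only [Nat.succ_ne_zero, if_false]
    set s := run L β γ₁ γ₂ αmax α₁ (k + 1) with hs
    obtain ⟨hT, hp, hst, -, hαt⟩ := ih
    have hnp := nextStep_pos (γ₁ := γ₁) (γ₂ := γ₂) hβ hgrad hαmax0 hα₁ hT.ne_zero hT.time_pos hp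
    obtain ⟨hb, he⟩ := stepBounds_of_le_nextStep hβ hαmax hα₁ hT.ne_zero hT.time_pos hst hnp.le
      le_rfl
    have hs1 := exp_sub_one_pos hα₁
    have h1 : nextStep L β γ₁ γ₂ αmax α₁ s.stepSize s.time s.iterate ≤ αmax :=
      (min_le_left _ _).trans (min_le_left _ _)
    exact ⟨(hT.step hL hγ₁ hb (by linarith) (by positivity) he).1, hnp,
      by linarith [hT.time_pos], by linarith, by linarith⟩

/-- The step from one grid point to the next. -/
theorem run_step (hL : LocalLipschitzHessian L D β γ₁ γ₂) (h0 : (0 : Param p) ∈ D)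
    (hgrad : gradient L 0 ≠ 0) (hγ₁ : 1 ≤ γ₁) (hαmax0 : 0 < αmax) (hαmax : αmax ≤ 1 / 10)
    (hα₁ : 0 < α₁) (hle : α₁ ≤ firstStepBound L β γ₁ γ₂ αmax ε α₁) (k : ℕ) :
    ∃ h, StepBounds β γ₁ γ₂ ((Real.exp α₁ - 1) * ‖gradient L 0‖)
        (run L β γ₁ γ₂ αmax α₁ (k + 1)).time h (run L β γ₁ γ₂ αmax α₁ (k + 1)).iterate ∧
      Real.exp (run L β γ₁ γ₂ αmax α₁ (k + 2)).time - 1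
        = (1 + h) * (Real.exp (run L β γ₁ γ₂ αmax α₁ (k + 1)).time - 1) ∧
      ‖(run L β γ₁ γ₂ αmax α₁ (k + 2)).iterate‖
        ≤ 5 * ‖(run L β γ₁ γ₂ αmax α₁ (k + 1)).iterate‖ := by
  have hβ := hL.beta_pos
  rw [run]
  obtain ⟨hT, hp, hst, -, hαt⟩ := run_tracks hL h0 hgrad hγ₁ hαmax0 hαmax hα₁ hle k
  set s := run L β γ₁ γ₂ αmax α₁ (k + 1) with hs
  have hnp := nextStep_pos (γ₁ := γ₁) (γ₂ := γ₂) hβ hgrad hαmax0 hα₁ hT.ne_zero hT.time_pos hp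
  obtain ⟨hb, he⟩ := stepBounds_of_le_nextStep hβ hαmax hα₁ hT.ne_zero hT.time_pos hst hnp.le
    le_rfl
  have hs1 := exp_sub_one_pos hα₁
  exact ⟨_, hb, he, (hT.step hL hγ₁ hb (by linarith) (by positivity) he).2⟩

/-- A lower bound for the step sizes before termination, uniform in the precision. -/
theorem exists_le_stepSize (hL : LocalLipschitzHessian L D β γ₁ γ₂) (h0 : (0 : Param p) ∈ D)
    (hgrad : gradient L 0 ≠ 0) (hγ₁ : 1 ≤ γ₁) {tmax : ℝ≥0∞}
    {ϑ : Param p} (hϑ : IsSolution L D tmax ϑ)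
    (hαmax0 : 0 < αmax) (hαmax : αmax ≤ 1 / 10) :
    ∃ κ : ℝ, 0 < κ ∧ ∀ ε α₁ : ℝ, 0 < α₁ → α₁ ≤ firstStepBound L β γ₁ γ₂ αmax ε α₁ →
      ∀ k : ℕ, (∀ j, 1 ≤ j → j ≤ k →
          ¬ Terminates L tmax α₁ (run L β γ₁ γ₂ αmax α₁ j)) →
        κ * ((Real.exp α₁ - 1) * Real.exp ((run L β γ₁ γ₂ αmax α₁ k).time / 2))
          ≤ (run L β γ₁ γ₂ αmax α₁ (k + 1)).stepSize := by
  have hβ := hL.beta_pos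
  have hg : 0 < ‖gradient L 0‖ := norm_pos_iff.2 hgrad
  set S := 2 * (‖ϑ‖ + ‖gradient L 0‖) with hS
  have hS0 : 0 < S := by positivity
  -- Failure of the second stopping test, with ‖x‖ ≤ 2‖ϑ‖, gives (s₁e^{t/2})² ≤ s₁² + 8‖ϑ‖²/‖∇L(0)‖²
  -- ≤ Q, where s₁ = e^{α₁} - 1.
  set Q := 1 + 8 * ‖ϑ‖ ^ 2 / ‖gradient L 0‖ ^ 2 with hQ
  have hQ1 : 1 ≤ Q := le_add_of_nonneg_right (by positivity)
  have hQ0 : 0 < Q := by linarith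
  obtain ⟨κ, hκ0, hκ⟩ : ∃ κ : ℝ, 0 < κ ∧ κ ≤ 1 / 2 ∧ κ ≤ αmax / Q ∧ κ ≤ ‖gradient L 0‖ / (2 * S) ∧
      κ ≤ 1 / (1768 * β * S * Q) := by
    refine ⟨min (1 / 2) (min (αmax / Q) (min (‖gradient L 0‖ / (2 * S)) (1 / (1768 * β * S * Q)))),
      ?_, ?_⟩
    · simp only [lt_min_iff]; refine ⟨by norm_num, by positivity, by positivity, by positivity⟩
    · simp only [← le_min_iff]; exact le_rfl
  obtain ⟨hκ1, hκ2, hκ3, hκ4⟩ := hκ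
  rw [le_div_iff₀ hQ0] at hκ2
  rw [le_div_iff₀ (by positivity)] at hκ3 hκ4
  refine ⟨κ, hκ0, fun ε α₁ hα₁ hle k => ?_⟩
  have hs1 := exp_sub_one_pos hα₁
  have hα₁max : α₁ ≤ αmax := hle.trans (min_le_left _ _)
  have hs1' := exp_sub_one_le_two_mul hα₁.le (by linarith)
  induction k with
  | zero =>
    intro _
    simp only [run, if_true, zero_div, Real.exp_zero, mul_one]
    nlinarith
  | succ k ih =>
    intro hnt
    have ih := ih (fun j h1 h2 => hnt j h1 (by omega))
    have hnt := hnt (k + 1) (by omega) le_rfl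
    obtain ⟨hT, hp, hst, hst10, hαt⟩ := run_tracks hL h0 hgrad hγ₁ hαmax0 hαmax hα₁ hle k
    have htime : (run L β γ₁ γ₂ αmax α₁ (k + 1)).time
      = (run L β γ₁ γ₂ αmax α₁ k).time + (run L β γ₁ γ₂ αmax α₁ (k + 1)).stepSize := rfl
    have hstep : (run L β γ₁ γ₂ αmax α₁ (k + 1 + 1)).stepSize
      = nextStep L β γ₁ γ₂ αmax α₁ (run L β γ₁ γ₂ αmax α₁ (k + 1)).stepSize
        (run L β γ₁ γ₂ αmax α₁ (k + 1)).time (run L β γ₁ γ₂ αmax α₁ (k + 1)).iterate := by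
      conv_lhs => rw [run]
      simp
    rw [hstep]
    set s := run L β γ₁ γ₂ αmax α₁ (k + 1) with hs
    simp only [Terminates, not_or, not_lt, not_le] at hnt
    have hxϑ := hT.norm_le_of_isMinOn hL hnt.1 hϑ.1 hϑ.2.1
    have hxS := hT.norm_le_mul_one_sub_exp_neg hL h0 hnt.1 hϑ.1 hϑ.2.1
    have hst0 := exp_sub_one_pos hT.time_pos
    refine Tracks.le_nextStep hL hgrad hγ₁ hα₁ hαt hS0 hT.ne_zero hxS ?_ hQ1 hκ0 (by linarith)
      hκ2 hκ3 hκ4 ?_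
    · have h1 := hnt.2
      rw [lt_div_iff₀ hst0] at h1
      have h2 : ‖s.iterate‖ ^ 2 ≤ (2 * ‖ϑ‖) ^ 2 := by gcongr
      set y := (Real.exp α₁ - 1) * Real.exp (s.time / 2) with hy
      have hy0 : 0 ≤ y := by positivity
      have h3 : y ^ 2 = (Real.exp α₁ - 1) ^ 2 * Real.exp s.time := by
        rw [hy, mul_pow, ← Real.exp_nat_mul]; congr 2; push_cast; ring
      have h4 : (y ^ 2 - (Real.exp α₁ - 1) ^ 2) * ‖gradient L 0‖ ^ 2 ≤ 8 * ‖ϑ‖ ^ 2 := by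
        rw [h3]; nlinarith
      rw [← le_div_iff₀ (by positivity)] at h4
      have h5 : (Real.exp α₁ - 1) ^ 2 ≤ 1 := by
        rw [sq_le_one_iff₀ hs1.le]; linarith
      have h6 : y ^ 2 ≤ Q := by rw [hQ]; linarith
      by_contra hcon
      push Not at hcon
      have h7 : 1 * Q < y * y := mul_lt_mul' (hQ1.trans hcon.le) hcon hQ0.le (by linarith)
      linarith [pow_two y]
    -- The doubling cap is harmless: e^{t/2} itself at most doubles in one step, so the induction
    -- hypothesis covers it.
    · have h1 : Real.exp (s.time / 2)
        ≤ 2 * Real.exp ((run L β γ₁ γ₂ αmax α₁ k).time / 2) := by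
        rw [htime, add_div, Real.exp_add]
        have := exp_sub_one_le_two_mul (x := s.stepSize / 2) (by linarith) (by linarith)
        nlinarith [Real.exp_pos ((run L β γ₁ γ₂ αmax α₁ k).time / 2)]
      calc _ ≤ κ * ((Real.exp α₁ - 1) * (2 * Real.exp ((run L β γ₁ γ₂ αmax α₁ k).time / 2))) := by
            gcongr
        _ ≤ _ := by linarith

/-- The potential e^{-t/2} falls by at least e^{-t/2}α/4 per step, and the lower bound on α cancels
the exponential. The total is at most 1 whatever the final time. -/
theorem mul_le_one_of_not_terminates (hL : LocalLipschitzHessian L D β γ₁ γ₂)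
    (h0 : (0 : Param p) ∈ D)
    (hgrad : gradient L 0 ≠ 0) (hγ₁ : 1 ≤ γ₁) (hαmax0 : 0 < αmax) (hαmax : αmax ≤ 1 / 10)
    (hα₁ : 0 < α₁) (hle : α₁ ≤ firstStepBound L β γ₁ γ₂ αmax ε α₁) {κ : ℝ} (n : ℕ)
    (h : ∀ k < n, κ * ((Real.exp α₁ - 1) * Real.exp ((run L β γ₁ γ₂ αmax α₁ k).time / 2))
          ≤ (run L β γ₁ γ₂ αmax α₁ (k + 1)).stepSize) :
    n * (κ * (Real.exp α₁ - 1) / 4) ≤ 1 - Real.exp (-((run L β γ₁ γ₂ αmax α₁ n).time / 2)) := by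
  induction n with
  | zero => simp [run]
  | succ n ih =>
    have ih := ih (fun k hk => h k (by omega))
    have hn := h n (by omega)
    obtain ⟨-, hp, -, hst10, -⟩ := run_tracks hL h0 hgrad hγ₁ hαmax0 hαmax hα₁ hle n
    have htime : (run L β γ₁ γ₂ αmax α₁ (n + 1)).time
      = (run L β γ₁ γ₂ αmax α₁ n).time + (run L β γ₁ γ₂ αmax α₁ (n + 1)).stepSize := rfl
    set α := (run L β γ₁ γ₂ αmax α₁ (n + 1)).stepSize with hα
    set τ := (run L β γ₁ γ₂ αmax α₁ n).time with hτ
    rw [htime, add_div, neg_add, Real.exp_add]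
    have h1 : Real.exp (-(α / 2)) ≤ 1 - α / 4 := by
      have h2 := Real.add_one_le_exp (α / 2)
      have h3 : Real.exp (α / 2) * Real.exp (-(α / 2)) = 1 := by rw [← Real.exp_add]; simp
      nlinarith [Real.exp_pos (-(α / 2))]
    have h4 := mul_le_mul_of_nonneg_left h1 (Real.exp_pos (-(τ / 2))).le
    have h5 := mul_le_mul_of_nonneg_left hn (Real.exp_pos (-(τ / 2))).le
    have h6 : Real.exp (-(τ / 2)) * Real.exp (τ / 2) = 1 := by rw [← Real.exp_add]; simp
    have h7 : Real.exp (-(τ / 2)) * (κ * ((Real.exp α₁ - 1) * Real.exp (τ / 2)))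
      = κ * (Real.exp α₁ - 1) := by
      calc _ = κ * (Real.exp α₁ - 1) * (Real.exp (-(τ / 2)) * Real.exp (τ / 2)) := by ring
        _ = _ := by rw [h6, mul_one]
    push_cast
    linarith

/-- The upper bound for the first step size is at least of the order of `min 1 √ε`. -/
theorem exists_le_firstStepBound (hL : LocalLipschitzHessian L D β γ₁ γ₂)
    (hgrad : gradient L 0 ≠ 0) (hαmax0 : 0 < αmax) :
    ∃ c₀ : ℝ, 0 < c₀ ∧ ∀ ε α : ℝ, 0 < ε →
      c₀ * min 1 (Real.sqrt ε) ≤ firstStepBound L β γ₁ γ₂ αmax ε α := by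
  have hβ := hL.beta_pos
  have hg : 0 < ‖gradient L 0‖ := norm_pos_iff.2 hgrad
  have hm0 : 0 < min (2 - γ₁) (1 - γ₂ / 2) :=
    lt_min (by linarith [hL.gamma_one_mem.2]) (by linarith [hL.gamma_two_mem.2])
  set m := min (2 - γ₁) (1 - γ₂ / 2) with hm
  set ν := sSup (spectrum ℝ (hess L 0)) with hν
  -- A bound for C₁ that is independent of the first step size.
  set Cb := max (15 * max 1 (ν ^ (γ₁ - 1))) (Real.sqrt 2 * constC₂) with hCb
  have hCb0 : 0 < Cb := lt_max_of_lt_right (by unfold constC₂; positivity)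
  set b := (Cb * β * ‖gradient L 0‖) ^ (-(1 / m)) with hb
  have hb0 : 0 < b := Real.rpow_pos_of_pos (by positivity) _
  have hlog : 0 < Real.log (1 + b) := Real.log_pos (by linarith)
  refine ⟨min αmax (min (1 / (‖gradient L 0‖ + 1)) (Real.log (1 + b))), by positivity,
    fun ε α hε => ?_⟩
  set z := min 1 (Real.sqrt ε) with hz
  have hz0 : 0 < z := lt_min one_pos (Real.sqrt_pos.2 hε)
  have hz1 : z ≤ 1 := min_le_left _ _
  have hzε : z ≤ Real.sqrt ε := min_le_right _ _
  rw [firstStepBound, min_mul_of_nonneg _ _ hz0.le, min_mul_of_nonneg _ _ hz0.le]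
  apply min_le_min (mul_le_of_le_one_right hαmax0.le hz1)
  apply min_le_min
  · have h1 : Real.log (1 + z / ‖gradient L 0‖) ≤ Real.log (1 + Real.sqrt ε / ‖gradient L 0‖) := by
      apply Real.log_le_log (by positivity); gcongr
    refine le_trans ?_ h1
    have h2 := Real.one_sub_inv_le_log_of_pos (x := 1 + z / ‖gradient L 0‖) (by positivity)
    refine le_trans ?_ h2
    have h3 : 1 - (1 + z / ‖gradient L 0‖)⁻¹ = z / (‖gradient L 0‖ + z) := by field_simp; ring
    rw [h3, one_div_mul_eq_div]
    gcongr
  · refine (mul_le_of_le_one_right hlog.le hz1).trans ?_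
    have hX := hL.max_const_pos hgrad α
    apply Real.log_le_log (by positivity)
    rw [← hm]
    gcongr 1 + ?_
    apply Real.rpow_le_rpow_of_nonpos hX
    · have : constC₁ L γ₁ α ≤ 15 * max 1 (ν ^ (γ₁ - 1)) := by
        unfold constC₁
        split_ifs
        · linarith [le_max_left 1 (ν ^ (γ₁ - 1))]
        · have h1 := le_max_right 1 (ν ^ (γ₁ - 1))
          have h2 := min_le_left (ν ^ (γ₁ - 1))
            (ν ^ γ₁ * (Real.exp (-α) * (1 - Real.exp (-α))))
          linarith
      have : max (constC₁ L γ₁ α) (Real.sqrt 2 * constC₂) ≤ Cb := max_le_max this le_rfl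
      gcongr
    · rw [neg_nonpos]; positivity

end

/-! ### Errors in the objective -/

theorem expNeg_nonneg (t : ℝ≥0∞) : 0 ≤ expNeg t := by
  unfold expNeg; split_ifs <;> positivity

theorem expNeg_le_exp_neg {τ : ℝ} {t : ℝ≥0∞} (h : ENNReal.ofReal τ ≤ t) :
    expNeg t ≤ Real.exp (-τ) := by
  unfold expNeg
  split_ifs with ht
  · positivity
  · exact Real.exp_le_exp.2 (neg_le_neg ((ENNReal.ofReal_le_iff_le_toReal ht).1 h))

theorem expNeg_antitone {t t' : ℝ≥0∞} (h : t ≤ t') : expNeg t' ≤ expNeg t := by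
  rcases eq_or_ne t ⊤ with rfl | ht
  · rw [top_le_iff.1 h]
  · refine (expNeg_le_exp_neg (τ := t.toReal) (by rwa [ENNReal.ofReal_toReal ht])).trans ?_
    rw [expNeg, if_neg ht]

theorem expNeg_le_one (t : ℝ≥0∞) : expNeg t ≤ 1 := by
  simpa using expNeg_le_exp_neg (τ := 0) (t := t) (by simp)

section

variable {L : Param p → ℝ} {D : Set (Param p)} {β γ₁ γ₂ αmax ε α₁ A : ℝ}

theorem objective_eq {t : ℝ≥0∞} (ht : t ≠ ⊤) (x : Param p) :
    objective L t x = Real.exp (-t.toReal) * ((Real.exp t.toReal - 1) * L x + ‖x‖ ^ 2 / 2) := by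
  have h : Real.exp (-t.toReal) * Real.exp t.toReal = 1 := by rw [← Real.exp_add]; simp
  rw [objective, expNeg, if_neg ht]
  linear_combination (-L x) * h

/-- s∇L(x) = g - x, and g is small relative to x. -/
theorem Tracks.norm_gradient_le {x : Param p} {t : ℝ} (hx : Tracks L D β γ₁ γ₂ A t x) :
    (Real.exp t - 1) * ‖gradient L x‖ ≤ 3 / 2 * ‖x‖ := by
  have hs := exp_sub_one_pos hx.time_pos
  have h1 : (Real.exp t - 1) • gradient L x = scaledGrad L (Real.exp t - 1) x - x := by
    simp [scaledGrad]
  have h2 := norm_sub_le (scaledGrad L (Real.exp t - 1) x) x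
  rw [← h1, norm_smul, Real.norm_of_nonneg hs.le] at h2
  linarith [hx.relative, norm_nonneg x]

namespace LocalLipschitzHessian

theorem convexOn_objective (hL : LocalLipschitzHessian L D β γ₁ γ₂) (t : ℝ≥0∞) :
    ConvexOn ℝ D (objective L t) := by
  have h1 : ConvexOn ℝ D (fun x => (1 - expNeg t) • L x) :=
    hL.convex.smul (by linarith [expNeg_le_one t])
  have h2 : ConvexOn ℝ D (fun x : Param p => (expNeg t / 2) • ‖x‖ ^ 2) :=
    ((convexOn_norm hL.convex.1).pow (fun _ _ => norm_nonneg _) 2).smul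
      (by linarith [expNeg_nonneg t])
  exact h1.add h2

/-- The factor e^{-t} between f_t and s L + ½‖·‖² absorbs the square of e^{t/2}. -/
theorem objective_sub_le (hL : LocalLipschitzHessian L D β γ₁ γ₂) {t : ℝ≥0∞} (ht : t ≠ ⊤)
    {x y : Param p} (hx : x ∈ D) (hy : y ∈ D) {B : ℝ}
    (h : ‖scaledGrad L (Real.exp t.toReal - 1) x‖ ≤ B * Real.exp (t.toReal / 2)) :
    objective L t x - objective L t y ≤ B ^ 2 / 2 := by
  rw [objective_eq ht, objective_eq ht, ← mul_sub]
  have h1 := hL.scaled_sub_le hx hy (s := Real.exp t.toReal - 1)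
    (by linarith [Real.one_le_exp (ENNReal.toReal_nonneg (a := t))])
  have h2 : ‖scaledGrad L (Real.exp t.toReal - 1) x‖ ^ 2 ≤ B ^ 2 * Real.exp t.toReal := by
    have h3 := pow_le_pow_left₀ (norm_nonneg _) h 2
    have h4 : Real.exp (t.toReal / 2) ^ 2 = Real.exp t.toReal := by
      rw [← Real.exp_nat_mul]; congr 1; push_cast; ring
    rwa [mul_pow, h4] at h3
  have h5 : Real.exp (-t.toReal) * Real.exp t.toReal = 1 := by rw [← Real.exp_add]; simp
  calc _ ≤ Real.exp (-t.toReal) * (B ^ 2 * Real.exp t.toReal / 2) := by gcongr; linarith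
    _ = B ^ 2 / 2 * (Real.exp (-t.toReal) * Real.exp t.toReal) := by ring
    _ = _ := by rw [h5, mul_one]

/-- Existence of the solution path. -/
theorem exists_isSolution (hL : LocalLipschitzHessian L D β γ₁ γ₂) (h0 : (0 : Param p) ∈ D)
    {t : ℝ≥0∞} (ht : t ≠ ⊤) : ∃ ϑ, IsSolution L D t ϑ := by
  set u := expNeg t with hu
  have hu0 : 0 < u := by rw [hu, expNeg, if_neg ht]; positivity
  have hu1 : u ≤ 1 := expNeg_le_one t
  -- At t = 0 the loss has weight 0 and cannot be isolated from the objective; the minimizer is 0.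
  rcases hu1.eq_or_lt with h1 | h1
  · refine ⟨0, h0, fun y _ => ?_, fun y _ _ => by simp⟩
    simp only [mem_ofPred_eq, objective, ← hu, h1]
    have := sq_nonneg ‖y‖
    simp
  have hcont : ContinuousOn L D := fun x hx =>
    (hL.differentiable x hx).continuousAt.continuousWithinAt
  have hobj : ContinuousOn (objective L t) D := by
    unfold objective
    fun_prop
  set C : Set (Param p) := {x | x ∈ D ∧ objective L t x ≤ objective L t 0} with hC
  have hCD : C ⊆ D := fun x hx => hx.1
  have hCeq : C = (fun x : Param p => (x, (objective L t 0 - u / 2 * ‖x‖ ^ 2) / (1 - u))) ⁻¹'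
      {q : Param p × ℝ | q.1 ∈ D ∧ L q.1 ≤ q.2} := by
    ext x
    simp only [hC, mem_ofPred_eq, mem_preimage]
    rw [le_div_iff₀ (by linarith)]
    refine and_congr_right fun _ => ?_
    simp only [objective, ← hu]
    constructor <;> intro h <;> linarith
  have hclosed : IsClosed C := by
    rw [hCeq]
    exact hL.closed.preimage (by fun_prop)
  have hbdd : Bornology.IsBounded C := by
    refine (Metric.isBounded_closedBall (x := (0 : Param p))
      (r := 2 * ‖gradient L 0‖ / u)).subset fun x hx => ?_
    rw [mem_closedBall_zero_iff, le_div_iff₀ hu0]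
    have h2 := hL.first_order h0 hx.1
    have h3 := neg_le_of_abs_le (abs_real_inner_le_norm (gradient L 0) (x - 0))
    rw [sub_zero] at h2 h3
    have h4 := hx.2
    simp only [objective, ← hu, norm_zero] at h4
    have h5 : u / 2 * ‖x‖ ^ 2 ≤ (1 - u) * (‖gradient L 0‖ * ‖x‖) := by
      have := mul_le_mul_of_nonneg_left h2 (sub_nonneg.2 hu1)
      have := mul_le_mul_of_nonneg_left h3 (sub_nonneg.2 hu1)
      nlinarith
    have h6 : (1 - u) * (‖gradient L 0‖ * ‖x‖) ≤ ‖gradient L 0‖ * ‖x‖ :=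
      mul_le_of_le_one_left (by positivity) (by linarith)
    rcases (norm_nonneg x).eq_or_lt with h | h
    · rw [← h]; simp
    · have : (u / 2 * ‖x‖) * ‖x‖ ≤ ‖gradient L 0‖ * ‖x‖ := by nlinarith
      have := le_of_mul_le_mul_right this h
      linarith
  have hcomp : IsCompact C := Metric.isCompact_of_isClosed_isBounded hclosed hbdd
  obtain ⟨ϑ, hϑC, hϑ⟩ := hcomp.exists_isMinOn ⟨0, h0, le_rfl⟩ (hobj.mono hCD)
  have hmin : IsMinOn (objective L t) D ϑ := by
    intro y hy
    rcases le_total (objective L t y) (objective L t 0) with h | h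
    · exact hϑ ⟨hy, h⟩
    · exact hϑC.2.trans h
  refine ⟨ϑ, hϑC.1, hmin, fun y hy hymin => ?_⟩
  have hyϑ : objective L t y ≤ objective L t ϑ := hymin hϑC.1
  have hhalf : (1 / 2 : ℝ) • ϑ + (1 / 2 : ℝ) • y ∈ D :=
    hL.convex.1 hϑC.1 hy (by norm_num) (by norm_num) (by norm_num)
  have hLhalf := hL.convex.2 hϑC.1 hy (show (0 : ℝ) ≤ 1 / 2 by norm_num)
    (show (0 : ℝ) ≤ 1 / 2 by norm_num) (by norm_num)
  have hmid : objective L t ϑ ≤ objective L t ((1 / 2 : ℝ) • ϑ + (1 / 2 : ℝ) • y) := hmin hhalf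
  -- The parallelogram identity makes the midpoint of two distinct minimizers strictly better, hence
  -- uniqueness.
  have hpar : ‖(1 / 2 : ℝ) • ϑ + (1 / 2 : ℝ) • y‖ ^ 2
      = ‖ϑ‖ ^ 2 / 2 + ‖y‖ ^ 2 / 2 - ‖ϑ - y‖ ^ 2 / 4 := by
    rw [norm_add_sq_real, norm_sub_sq_real, norm_smul, norm_smul, inner_smul_left,
      inner_smul_right]
    simp; ring
  simp only [objective, ← hu, smul_eq_mul] at hyϑ hmid hLhalf
  rw [hpar] at hmid
  have h7 := mul_le_mul_of_nonneg_left hLhalf (sub_nonneg.2 hu1)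
  have h8 : u * ‖ϑ - y‖ ^ 2 ≤ 0 := by nlinarith
  have h9 : ‖ϑ - y‖ = 0 := by
    by_contra hne
    have : 0 < ‖ϑ - y‖ := lt_of_le_of_ne (norm_nonneg _) (Ne.symm hne)
    have : 0 < u * ‖ϑ - y‖ ^ 2 := by positivity
    linarith
  rw [sub_eq_zero.1 (norm_eq_zero.1 h9)]

/-- Iterates are bounded below away from the start of the path. -/
theorem exists_norm_ge (hL : LocalLipschitzHessian L D β γ₁ γ₂) (h0 : (0 : Param p) ∈ D)
    (hgrad : gradient L 0 ≠ 0) : ∃ b : ℝ, 0 < b ∧ ∀ A t x, Tracks L D β γ₁ γ₂ A t x →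
      b * min 1 (Real.exp t - 1) ≤ ‖x‖ := by
  have hg : 0 < ‖gradient L 0‖ := norm_pos_iff.2 hgrad
  obtain ⟨ρ, hρ, hball⟩ := Metric.continuousAt_iff.1 (hL.twice_differentiable 0 h0).continuousAt
    (‖gradient L 0‖ / 2) (by positivity)
  refine ⟨min ρ (‖gradient L 0‖ / 6), by positivity, fun A t x hx => ?_⟩
  have hs := exp_sub_one_pos hx.time_pos
  have hmin0 : 0 < min 1 (Real.exp t - 1) := lt_min one_pos hs
  -- Near 0 the gradient has norm at least ‖∇L(0)‖/2, and (e^t - 1)‖∇L(x)‖ ≤ (3/2)‖x‖.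
  rcases lt_or_ge ‖x‖ ρ with h | h
  · have h1 := hball (x := x) (by simpa using h)
    rw [dist_eq_norm] at h1
    have h2 : ‖gradient L 0‖ / 2 ≤ ‖gradient L x‖ := by
      have := norm_sub_norm_le (gradient L 0) (gradient L x)
      rw [norm_sub_rev] at this
      linarith
    have h3 := hx.norm_gradient_le
    have h4 : (Real.exp t - 1) * (‖gradient L 0‖ / 2) ≤ (Real.exp t - 1) * ‖gradient L x‖ := by
      gcongr
    calc min ρ (‖gradient L 0‖ / 6) * min 1 (Real.exp t - 1)
        ≤ ‖gradient L 0‖ / 6 * (Real.exp t - 1) := by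
          gcongr
          · exact min_le_right _ _
          · exact min_le_right _ _
      _ ≤ ‖x‖ := by linarith [norm_nonneg x]
  · calc min ρ (‖gradient L 0‖ / 6) * min 1 (Real.exp t - 1) ≤ ρ * 1 := by
          gcongr
          · exact min_le_left _ _
          · exact min_le_left _ _
      _ ≤ ‖x‖ := by linarith

end LocalLipschitzHessian

/-- The error of the iterates along a step of the algorithm. -/
theorem Tracks.norm_scaledGrad_le {t t' h : ℝ} {x x' : Param p} (hA : 0 ≤ A)
    (hx : Tracks L D β γ₁ γ₂ A t x) (hx' : Tracks L D β γ₁ γ₂ A t' x')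
    (hb : StepBounds β γ₁ γ₂ A t h x)
    (hs' : Real.exp t' - 1 = (1 + h) * (Real.exp t - 1)) (hxx : ‖x'‖ ≤ 5 * ‖x‖)
    {τ : ℝ} (h1 : t ≤ τ) (h2 : τ ≤ t') :
    ‖scaledGrad L (Real.exp τ - 1) x‖ ≤ 6 * A * Real.exp (τ / 2) ∧
    ‖scaledGrad L (Real.exp τ - 1) x'‖ ≤ 6 * A * Real.exp (τ / 2) := by
  have hs := exp_sub_one_pos hx.time_pos
  have hs'0 := exp_sub_one_pos hx'.time_pos
  have hst : Real.exp t - 1 ≤ Real.exp τ - 1 := by linarith [Real.exp_le_exp.2 h1]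
  have hst' : Real.exp τ - 1 ≤ Real.exp t' - 1 := by linarith [Real.exp_le_exp.2 h2]
  have hhalf : Real.exp (t / 2) ≤ Real.exp (τ / 2) := Real.exp_le_exp.2 (by linarith)
  have hAh : A * Real.exp (t / 2) ≤ A * Real.exp (τ / 2) := by gcongr
  have hA0 : 0 ≤ A * Real.exp (t / 2) := by positivity
  obtain ⟨hh0, hh3, hbacc, -, -⟩ := hb
  constructor
  -- The old iterate is carried forward to τ, at cost 4/20 + 1.
  · set h'' := (Real.exp τ - 1) / (Real.exp t - 1) - 1 with hh''
    have e1 : Real.exp τ - 1 = (1 + h'') * (Real.exp t - 1) := by rw [hh'']; field_simp; ring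
    have h3 : 0 ≤ h'' := by
      rw [hh'', sub_nonneg, le_div_iff₀ hs]; linarith
    have h4 : h'' ≤ h := by
      have : (1 + h'') * (Real.exp t - 1) ≤ (1 + h) * (Real.exp t - 1) := by linarith
      linarith [le_of_mul_le_mul_right this hs]
    have h5 := norm_scaledGrad_rescale_le (L := L) hs e1 h3 x
    have h6 : h'' * ‖x‖ ≤ h * ‖x‖ := by gcongr
    have h7 : (1 + h'') * ‖scaledGrad L (Real.exp t - 1) x‖
        ≤ 4 * (A * Real.exp (t / 2) / 20) :=
      mul_le_mul (by linarith) hx.accuracy (norm_nonneg _) (by norm_num)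
    linarith
  -- The new iterate is carried backward to τ. The cost is 2/20 + 5, which determines the constant
  -- 6.
  · set ρ := (Real.exp τ - 1) / (Real.exp t' - 1) with hρ
    have hρ0 : 0 ≤ ρ := div_nonneg (by linarith) hs'0.le
    have hρ1 : ρ ≤ 1 := by rw [hρ, div_le_one hs'0]; exact hst'
    have hρh : 1 - ρ ≤ h := by
      have h3 : 1 / (1 + h) ≤ ρ := by
        rw [hρ, div_le_div_iff₀ (by linarith) hs'0, hs']
        nlinarith
      have h4 : 1 - h ≤ 1 / (1 + h) := by
        rw [le_div_iff₀ (by linarith)]; nlinarith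
      linarith
    have h5 : ‖scaledGrad L (Real.exp τ - 1) x'‖
        ≤ ρ * ‖scaledGrad L (Real.exp t' - 1) x'‖ + (1 - ρ) * ‖x'‖ := by
      rw [LocalLipschitzHessian.scaledGrad_rescale hs'0.ne' x', ← hρ, ← neg_sub 1 ρ, neg_smul,
        sub_neg_eq_add]
      refine (norm_add_le _ _).trans ?_
      rw [norm_smul, norm_smul, Real.norm_of_nonneg hρ0, Real.norm_of_nonneg (by linarith)]
    have h6 : Real.exp (t' / 2) ≤ 2 * Real.exp (t / 2) := by
      have e1 : Real.exp (t' / 2) ^ 2 = Real.exp t' := by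
        rw [← Real.exp_nat_mul]; congr 1; push_cast; ring
      have e2 : Real.exp (t / 2) ^ 2 = Real.exp t := by
        rw [← Real.exp_nat_mul]; congr 1; push_cast; ring
      refine (sq_le_sq₀ (by positivity) (by positivity)).1 ?_
      rw [mul_pow, e1, e2]
      nlinarith
    have h7 : ρ * ‖scaledGrad L (Real.exp t' - 1) x'‖ ≤ A * Real.exp (t' / 2) / 20 :=
      (mul_le_of_le_one_left (norm_nonneg _) hρ1).trans hx'.accuracy
    have h8 : (1 - ρ) * ‖x'‖ ≤ h * (5 * ‖x‖) :=
      mul_le_mul hρh hxx (norm_nonneg _) hh0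
    have h9 : A * Real.exp (t' / 2) ≤ A * (2 * Real.exp (t / 2)) := by gcongr
    linarith

/-- The error along the first step. -/
theorem Tracks.norm_scaledGrad_le_first {x' : Param p} (hα₁ : 0 < α₁) (hα₁' : α₁ ≤ 1 / 10)
    (hx' : Tracks L D β γ₁ γ₂ ((Real.exp α₁ - 1) * ‖gradient L 0‖) α₁ x')
    (hxx : ‖x'‖ ≤ (Real.exp α₁ - 1) * ‖gradient L 0‖)
    {τ : ℝ} (h1 : 0 ≤ τ) (h2 : τ ≤ α₁) :
    ‖scaledGrad L (Real.exp τ - 1) 0‖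
      ≤ 6 * ((Real.exp α₁ - 1) * ‖gradient L 0‖) * Real.exp (τ / 2) ∧
    ‖scaledGrad L (Real.exp τ - 1) x'‖
      ≤ 6 * ((Real.exp α₁ - 1) * ‖gradient L 0‖) * Real.exp (τ / 2) := by
  have hs := exp_sub_one_pos hα₁
  have hτ0 : 0 ≤ Real.exp τ - 1 := by linarith [Real.one_le_exp h1]
  have hst' : Real.exp τ - 1 ≤ Real.exp α₁ - 1 := by linarith [Real.exp_le_exp.2 h2]
  have hacc := hx'.accuracy
  set A := (Real.exp α₁ - 1) * ‖gradient L 0‖ with hA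
  have hA0 : 0 ≤ A := by positivity
  have hhalf : A * 1 ≤ A * Real.exp (τ / 2) := by
    gcongr; exact Real.one_le_exp (by linarith)
  constructor
  · have : ‖scaledGrad L (Real.exp τ - 1) 0‖ ≤ A := by
      rw [scaledGrad, add_zero, norm_smul, Real.norm_of_nonneg hτ0, hA]
      gcongr
    linarith
  · set ρ := (Real.exp τ - 1) / (Real.exp α₁ - 1) with hρ
    have hρ0 : 0 ≤ ρ := div_nonneg (by linarith) hs.le
    have hρ1 : ρ ≤ 1 := by rw [hρ, div_le_one hs]; exact hst'
    have h5 : ‖scaledGrad L (Real.exp τ - 1) x'‖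
        ≤ ρ * ‖scaledGrad L (Real.exp α₁ - 1) x'‖ + (1 - ρ) * ‖x'‖ := by
      rw [LocalLipschitzHessian.scaledGrad_rescale hs.ne' x', ← hρ, ← neg_sub 1 ρ, neg_smul,
        sub_neg_eq_add]
      refine (norm_add_le _ _).trans ?_
      rw [norm_smul, norm_smul, Real.norm_of_nonneg hρ0, Real.norm_of_nonneg (by linarith)]
    have h7 : ρ * ‖scaledGrad L (Real.exp α₁ - 1) x'‖ ≤ A * Real.exp (α₁ / 2) / 20 :=
      (mul_le_of_le_one_left (norm_nonneg _) hρ1).trans hacc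
    have h8 : (1 - ρ) * ‖x'‖ ≤ ‖x'‖ := mul_le_of_le_one_left (norm_nonneg _) (by linarith)
    have h9 : A * Real.exp (α₁ / 2) ≤ A * 2 := by
      gcongr
      have := exp_sub_one_le_two_mul (x := α₁ / 2) (by linarith) (by linarith)
      linarith
    linarith

/-- The error after termination. -/
theorem Tracks.objective_sub_le_of_terminates (hL : LocalLipschitzHessian L D β γ₁ γ₂)
    {T : ℝ≥0∞} {ϑ : Param p} (hϑ : ϑ ∈ D) (hmin : IsMinOn (objective L T) D ϑ)
    {b s₁ t : ℝ} {x : Param p} (hb : 0 < b) (hxb : b * min 1 (Real.exp t - 1) ≤ ‖x‖)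
    (hx : Tracks L D β γ₁ γ₂ A t x) (hs₁ : 0 < s₁) (hs₁t : s₁ ≤ Real.exp t - 1)
    (hA : A = s₁ * ‖gradient L 0‖)
    (hterm : 2 * ‖x‖ ^ 2 / (Real.exp t - 1) ≤ A ^ 2)
    {τ : ℝ≥0∞} (hτ : ENNReal.ofReal t ≤ τ) (hτT : τ ≤ T) {y : Param p} (hy : y ∈ D) :
    objective L τ x - objective L τ y
      ≤ (2 + 2 * ‖ϑ‖ * (1 / (2 * b) + ‖gradient L 0‖ ^ 2 / (4 * b ^ 3))) * A ^ 2 := by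
  have hs := exp_sub_one_pos hx.time_pos
  have hgrad := hx.norm_gradient_le
  set s := Real.exp t - 1 with hsdef
  have hu1 : expNeg τ ≤ Real.exp (-t) := expNeg_le_exp_neg hτ
  have hu0 := expNeg_nonneg τ
  have hU0 := expNeg_nonneg T
  have hU := expNeg_antitone hτT
  have ht1 : Real.exp (-t) < 1 := Real.exp_lt_one_iff.2 (by linarith [hx.time_pos])
  have hts : Real.exp (-t) * s ≤ 1 := by
    have : Real.exp (-t) * Real.exp t = 1 := by rw [← Real.exp_add]; simp
    rw [hsdef, mul_sub, this]
    linarith [Real.exp_pos (-t)]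
  rw [div_le_iff₀ hs] at hterm
  set u := expNeg τ with hu
  -- A lower bound for every competitor through the single point ϑ; what remains is (1 - u)(L x - L
  -- ϑ) and the penalty at x.
  have hlow : (1 - u) * L ϑ ≤ objective L τ y := by
    have h1 : objective L T ϑ ≤ objective L T y := hmin hy
    simp only [objective, ← hu] at h1 ⊢
    rcases le_total (L ϑ) (L y) with h | h
    · have : (1 - u) * L ϑ ≤ (1 - u) * L y := mul_le_mul_of_nonneg_left h (by linarith)
      have : 0 ≤ u / 2 * ‖y‖ ^ 2 := by positivity
      linarith
    · have h2 : (1 - u) * (L ϑ - L y) ≤ (1 - expNeg T) * (L ϑ - L y) :=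
        mul_le_mul_of_nonneg_right (by linarith) (by linarith)
      have h3 : expNeg T / 2 * ‖y‖ ^ 2 ≤ u / 2 * ‖y‖ ^ 2 := by gcongr
      have h4 : 0 ≤ expNeg T / 2 * ‖ϑ‖ ^ 2 := by positivity
      linarith
  -- Termination bounds ‖x‖², so a linear bound needs ‖x‖ from below. For s ≥ 1 divide by b. For s ≤
  -- 1, ‖x‖ ≥ bs and A ≤ s‖∇L(0)‖ force s to be bounded below.
  have hxs : ‖x‖ ≤ (1 / (2 * b) + ‖gradient L 0‖ ^ 2 / (4 * b ^ 3)) * A ^ 2 * s := by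
    have hp1 : 0 ≤ 1 / (2 * b) * A ^ 2 * s := by positivity
    have hp2 : 0 ≤ ‖gradient L 0‖ ^ 2 / (4 * b ^ 3) * A ^ 2 * s := by positivity
    rcases le_total 1 s with h | h
    · rw [min_eq_left h, mul_one] at hxb
      have h1 : b * ‖x‖ ≤ ‖x‖ * ‖x‖ := by gcongr
      have h2 : ‖x‖ ≤ 1 / (2 * b) * A ^ 2 * s := by
        have : 1 / (2 * b) * A ^ 2 * s = (A ^ 2 * s) / (2 * b) := by ring
        rw [this, le_div_iff₀ (by positivity)]
        linarith
      linarith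
    · rw [min_eq_right h] at hxb
      have h1 : b * s * ‖x‖ ≤ ‖x‖ * ‖x‖ := by gcongr
      have h2 : 2 * b * ‖x‖ ≤ A ^ 2 := by
        have : (2 * b * ‖x‖) * s ≤ A ^ 2 * s := by linarith
        exact le_of_mul_le_mul_right this hs
      have h3 : 2 * b ^ 2 ≤ s * ‖gradient L 0‖ ^ 2 := by
        have h4 : 2 * b ^ 2 * s ≤ A ^ 2 := by
          have := mul_le_mul_of_nonneg_left hxb (by positivity : 0 ≤ 2 * b)
          linarith
        have h5 : A ^ 2 ≤ s * ‖gradient L 0‖ ^ 2 * s := by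
          have : s₁ * s₁ ≤ s * s := by gcongr
          rw [hA]
          have := mul_le_mul_of_nonneg_right this (sq_nonneg ‖gradient L 0‖)
          linarith
        exact le_of_mul_le_mul_right (h4.trans h5) hs
      have h6 : ‖x‖ ≤ ‖gradient L 0‖ ^ 2 / (4 * b ^ 3) * A ^ 2 * s := by
        have : ‖gradient L 0‖ ^ 2 / (4 * b ^ 3) * A ^ 2 * s
          = (s * ‖gradient L 0‖ ^ 2 * A ^ 2) / (4 * b ^ 3) := by ring
        rw [this, le_div_iff₀ (by positivity)]
        calc ‖x‖ * (4 * b ^ 3) = 2 * b ^ 2 * (2 * b * ‖x‖) := by ring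
          _ ≤ s * ‖gradient L 0‖ ^ 2 * A ^ 2 := by gcongr
      linarith
  set W := 1 / (2 * b) + ‖gradient L 0‖ ^ 2 / (4 * b ^ 3) with hW
  have hW0 : 0 ≤ W := by positivity
  have hLx : L x - L ϑ ≤ 3 / 2 * A ^ 2 + 2 * ‖ϑ‖ * W * A ^ 2 := by
    have h1 := hL.first_order hx.mem hϑ
    have h2 := neg_le_of_abs_le (abs_real_inner_le_norm (gradient L x) (ϑ - x))
    have h3 : ‖ϑ - x‖ ≤ ‖ϑ‖ + ‖x‖ := norm_sub_le _ _
    have h4 : s * (L x - L ϑ) ≤ s * (‖gradient L x‖ * ‖ϑ - x‖) := by gcongr; linarith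
    have h5 : s * ‖gradient L x‖ * ‖ϑ - x‖ ≤ 3 / 2 * ‖x‖ * (‖ϑ‖ + ‖x‖) := by gcongr
    have h6 := mul_le_mul_of_nonneg_left hxs (norm_nonneg ϑ)
    have h7 : (L x - L ϑ) * s ≤ (3 / 2 * A ^ 2 + 2 * ‖ϑ‖ * W * A ^ 2) * s := by
      have : 0 ≤ ‖ϑ‖ * (W * A ^ 2 * s) := by positivity
      have : 0 ≤ A ^ 2 * s := by positivity
      nlinarith
    exact le_of_mul_le_mul_right h7 hs
  have hux : u / 2 * ‖x‖ ^ 2 ≤ A ^ 2 / 2 := by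
    have h1 : u * ‖x‖ ^ 2 ≤ Real.exp (-t) * ‖x‖ ^ 2 := by gcongr
    have h2 : Real.exp (-t) * (2 * ‖x‖ ^ 2) ≤ Real.exp (-t) * (A ^ 2 * s) := by gcongr
    have h3 : A ^ 2 * (Real.exp (-t) * s) ≤ A ^ 2 * 1 := by gcongr
    have := sq_nonneg A
    linarith
  have hR : 0 ≤ 3 / 2 * A ^ 2 + 2 * ‖ϑ‖ * W * A ^ 2 := by positivity
  have h1 : (1 - u) * (L x - L ϑ) ≤ 3 / 2 * A ^ 2 + 2 * ‖ϑ‖ * W * A ^ 2 := by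
    rcases le_total (L x - L ϑ) 0 with h | h
    · have := mul_nonpos_of_nonneg_of_nonpos (by linarith : 0 ≤ 1 - u) h
      linarith
    · exact (mul_le_of_le_one_left h (by linarith)).trans hLx
  simp only [objective, ← hu] at hlow ⊢
  linarith

end

/-! ### Interpolation and assembly -/

/-- The interpolation at `t` is a convex combination of neighbouring iterates, or the last
iterate. -/
theorem interpolate_cases (s : ℕ → State p) (h0 : (s 0).time = 0)
    (hmono : ∀ k, (s k).time < (s (k + 1)).time) (n : ℕ) (t : ℝ≥0∞) :
    (t ≠ ⊤ ∧ ∃ k < n, (s k).time ≤ t.toReal ∧ t.toReal ≤ (s (k + 1)).time ∧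
      ∃ a b : ℝ, 0 ≤ a ∧ 0 ≤ b ∧ a + b = 1 ∧
        interpolate s n t = a • (s k).iterate + b • (s (k + 1)).iterate) ∨
    (ENNReal.ofReal (s n).time ≤ t ∧ interpolate s n t = (s n).iterate) := by
  have hnn : ∀ k, 0 ≤ (s k).time := fun k => by
    have := (strictMono_nat_of_lt_succ hmono).monotone (Nat.zero_le k)
    rwa [h0] at this
  induction n with
  | zero => right; simp [h0, interpolate]
  | succ n ih =>
    rw [interpolate]
    split_ifs with h1 h2
    · have htop : t ≠ ⊤ := ne_top_of_le_ne_top ENNReal.ofReal_ne_top h1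
      rcases ih with ⟨ht, k, hk, h⟩ | ⟨h, h'⟩
      · exact Or.inl ⟨ht, k, by omega, h⟩
      -- Here t is exactly the grid point t_n, taken as the left end of the next segment.
      · refine Or.inl ⟨htop, n, by omega, ?_, ?_, 1, 0, by norm_num, le_rfl, by norm_num, ?_⟩
        · rw [le_antisymm h1 h, ENNReal.toReal_ofReal (hnn n)]
        · rw [le_antisymm h1 h, ENNReal.toReal_ofReal (hnn n)]; exact (hmono n).le
        · simp [h']
    · have htop : t ≠ ⊤ := ne_top_of_le_ne_top ENNReal.ofReal_ne_top h2
      have h3 : (s n).time ≤ t.toReal :=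
        (ENNReal.ofReal_le_iff_le_toReal htop).1 (le_of_lt (not_le.1 h1))
      have h4 : t.toReal ≤ (s (n + 1)).time := by
        have := ENNReal.toReal_mono ENNReal.ofReal_ne_top h2
        rwa [ENNReal.toReal_ofReal (hnn _)] at this
      have h5 : 0 < (s (n + 1)).time - (s n).time := sub_pos.2 (hmono n)
      refine Or.inl ⟨htop, n, by omega, h3, h4, _, _, div_nonneg (by linarith) h5.le,
        div_nonneg (by linarith) h5.le, ?_, rfl⟩
      rw [← add_div, div_eq_one_iff_eq h5.ne']; ring
    · exact Or.inr ⟨le_of_lt (not_le.1 h2), rfl⟩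

end NewtonPath

end

theorem mainTheorem7 {p : ℕ} (L : NewtonPath.Param p → ℝ) (D : Set (NewtonPath.Param p))
    (β γ₁ γ₂ : ℝ) (hL : NewtonPath.LocalLipschitzHessian L D β γ₁ γ₂)
    (h0 : (0 : NewtonPath.Param p) ∈ D) (hgrad : gradient L 0 ≠ 0)
    (hγ₁ : 1 ≤ γ₁)
    (tmax : ℝ≥0∞) (htmax : 0 < tmax)
    (hfin : ∃ ϑ, NewtonPath.IsSolution L D tmax ϑ)
    (αmax : ℝ) (hαmax : 0 < αmax) (hαmax' : αmax ≤ 1 / 10)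
    (c : ℝ) (hc : 0 < c) (hc1 : c ≤ 1) :
    ∃ K K' : ℝ, ∀ ε : ℝ, 0 < ε → ∀ α₁ : ℝ,
      α₁ ≤ NewtonPath.firstStepBound L β γ₁ γ₂ αmax ε α₁ →
      c * NewtonPath.firstStepBound L β γ₁ γ₂ αmax ε α₁ ≤ α₁ →
      ∃ N : ℕ,
        IsLeast {n : ℕ | 1 ≤ n ∧ NewtonPath.Terminates L tmax α₁
          (NewtonPath.run L β γ₁ γ₂ αmax α₁ n)} N ∧
        (N : ℝ) ≤ K * max 1 (ε ^ (-(1 / 2) : ℝ)) ∧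
        ∀ t : ℝ≥0∞, t ≤ tmax →
          NewtonPath.interpolate (NewtonPath.run L β γ₁ γ₂ αmax α₁) N t ∈ D ∧
          ∃ ϑ, NewtonPath.IsSolution L D t ϑ ∧
            NewtonPath.objective L t
                (NewtonPath.interpolate (NewtonPath.run L β γ₁ γ₂ αmax α₁) N t)
              - NewtonPath.objective L t ϑ ≤ K' * ε := by
  open NewtonPath in
  obtain ⟨ϑ, hϑ⟩ := hfin
  obtain ⟨κ, hκ0, hκ⟩ := exists_le_stepSize hL h0 hgrad hγ₁ hϑ hαmax hαmax'
  obtain ⟨c₀, hc₀, hfirst⟩ := exists_le_firstStepBound hL hgrad hαmax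
  obtain ⟨b, hb0, hb⟩ := hL.exists_norm_ge h0 hgrad
  set W := 2 + 2 * ‖ϑ‖ * (1 / (2 * b) + ‖gradient L 0‖ ^ 2 / (4 * b ^ 3)) with hW
  have hW0 : 0 ≤ W := by positivity
  -- 18 = 6²/2 covers times up to t_N, W the times after it.
  refine ⟨4 / (κ * (c * c₀)), 18 + W, fun ε hε α₁ hle hge => ?_⟩
  have hα₁ : 0 < α₁ :=
    lt_of_lt_of_le (mul_pos hc (hL.firstStepBound_pos hgrad hαmax hε α₁)) hge
  have hs1 := exp_sub_one_pos hα₁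
  have htr := run_tracks hL h0 hgrad hγ₁ hαmax hαmax' hα₁ hle
  have hstep := run_step hL h0 hgrad hγ₁ hαmax hαmax' hα₁ hle
  have hκ := hκ ε α₁ hα₁ hle
  have hfirst1 := hL.tracks_first h0 hgrad hγ₁ hαmax' hα₁ hle
  have hα₁10 : α₁ ≤ 1 / 10 := (hle.trans (min_le_left _ _)).trans hαmax'
  have hsε := (hL.firstStep_bounds hgrad hγ₁ hαmax' hα₁ hle).2.1
  set A := (Real.exp α₁ - 1) * ‖gradient L 0‖ with hA
  have hA0 : 0 ≤ A := by positivity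
  have hAε : A ^ 2 ≤ ε := by
    have := pow_le_pow_left₀ hA0 hsε 2
    rwa [Real.sq_sqrt hε.le] at this
  have hcount : ∀ n : ℕ, (∀ j, 1 ≤ j → j < n →
      ¬ Terminates L tmax α₁ (run L β γ₁ γ₂ αmax α₁ j)) →
      (n : ℝ) * (κ * (Real.exp α₁ - 1) / 4) ≤ 1 := by
    intro n hn
    have := mul_le_one_of_not_terminates hL h0 hgrad hγ₁ hαmax hαmax' hα₁ hle n
      (fun k hk => hκ k (fun j h1 h2 => hn j h1 (by omega)))
    linarith [Real.exp_pos (-((run L β γ₁ γ₂ αmax α₁ n).time / 2))]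
  have hex : ∃ n, 1 ≤ n ∧ Terminates L tmax α₁ (run L β γ₁ γ₂ αmax α₁ n) := by
    by_contra hcon
    push Not at hcon
    obtain ⟨n, hn⟩ := exists_nat_gt (1 / (κ * (Real.exp α₁ - 1) / 4))
    have := hcount n (fun j h1 _ => hcon j h1)
    rw [div_lt_iff₀ (by positivity)] at hn
    linarith
  classical
  obtain ⟨N, hN⟩ : ∃ N, IsLeast {n : ℕ | 1 ≤ n ∧ Terminates L tmax α₁
      (run L β γ₁ γ₂ αmax α₁ n)} N :=
    ⟨Nat.find hex, Nat.find_spec hex, fun n hn => Nat.find_min' hex hn⟩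
  refine ⟨N, hN, ?_, fun t ht => ?_⟩
  · have h1 := hcount N (fun j h1 h2 h3 => absurd (hN.2 ⟨h1, h3⟩) (not_le.2 h2))
    have h2 : c * (c₀ * min 1 (Real.sqrt ε)) ≤ Real.exp α₁ - 1 := by
      have h3 := mul_le_mul_of_nonneg_left (hfirst ε α₁ hε) hc.le
      linarith [Real.add_one_le_exp α₁]
    set z := min 1 (Real.sqrt ε) with hz
    have hz0 : 0 < z := lt_min one_pos (Real.sqrt_pos.2 hε)
    have h3 : max 1 (ε ^ (-(1 / 2) : ℝ)) * z ≥ 1 := by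
      rw [Real.rpow_neg hε.le, ← Real.sqrt_eq_rpow]
      have hsq := Real.sqrt_pos.2 hε
      rcases le_total 1 (Real.sqrt ε) with h | h
      · rw [hz, min_eq_left h, mul_one]; exact le_max_left _ _
      · rw [hz, min_eq_right h]
        calc max 1 (Real.sqrt ε)⁻¹ * Real.sqrt ε ≥ (Real.sqrt ε)⁻¹ * Real.sqrt ε := by
              gcongr; exact le_max_right _ _
          _ = 1 := inv_mul_cancel₀ hsq.ne'
    have h4 : (N : ℝ) * (κ * (c * c₀ * z) / 4) ≤ 1 := by
      refine le_trans ?_ h1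
      gcongr
      linarith
    have h5 : (N : ℝ) * z ≤ 4 / (κ * (c * c₀)) := by
      rw [le_div_iff₀ (by positivity)]; linarith
    have hm0 : 0 ≤ max 1 (ε ^ (-(1 / 2) : ℝ)) := le_max_of_le_left zero_le_one
    calc (N : ℝ) = N * 1 := (mul_one _).symm
      _ ≤ N * (max 1 (ε ^ (-(1 / 2) : ℝ)) * z) := by gcongr
      _ = (N * z) * max 1 (ε ^ (-(1 / 2) : ℝ)) := by ring
      _ ≤ _ := by gcongr
  · have hmono : ∀ k, (run L β γ₁ γ₂ αmax α₁ k).time < (run L β γ₁ γ₂ αmax α₁ (k + 1)).time := by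
      intro k
      have e : (run L β γ₁ γ₂ αmax α₁ (k + 1)).time
        = (run L β γ₁ γ₂ αmax α₁ k).time + (run L β γ₁ γ₂ αmax α₁ (k + 1)).stepSize := rfl
      rw [e]; linarith [(htr k).2.1]
    have hmem : ∀ k, (run L β γ₁ γ₂ αmax α₁ k).iterate ∈ D := by
      intro k
      cases k with
      | zero => exact h0
      | succ k => exact (htr k).1.mem
    suffices hkey : interpolate (run L β γ₁ γ₂ αmax α₁) N t ∈ D ∧ ∀ y ∈ D,
        objective L t (interpolate (run L β γ₁ γ₂ αmax α₁) N t) - objective L t y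
          ≤ (18 + W) * ε by
      refine ⟨hkey.1, ?_⟩
      -- For t = ∞ existence of a solution is the hypothesis; for finite t it is proved.
      rcases eq_or_ne t ⊤ with rfl | htop
      · rw [top_le_iff.1 ht] at hϑ
        exact ⟨ϑ, hϑ, hkey.2 ϑ hϑ.1⟩
      · obtain ⟨y, hy⟩ := hL.exists_isSolution h0 htop
        exact ⟨y, hy, hkey.2 y hy.1⟩
    rcases interpolate_cases (run L β γ₁ γ₂ αmax α₁) rfl hmono N t with
      ⟨htop, k, -, hk1, hk2, a, a', ha, ha', haa, heq⟩ | ⟨hNt, heq⟩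
    · rw [heq]
      refine ⟨hL.convex.1 (hmem k) (hmem (k + 1)) ha ha' haa, fun y hy => ?_⟩
      have hboth : ‖scaledGrad L (Real.exp t.toReal - 1) (run L β γ₁ γ₂ αmax α₁ k).iterate‖
            ≤ 6 * A * Real.exp (t.toReal / 2) ∧
          ‖scaledGrad L (Real.exp t.toReal - 1) (run L β γ₁ γ₂ αmax α₁ (k + 1)).iterate‖
            ≤ 6 * A * Real.exp (t.toReal / 2) := by
        cases k with
        | zero =>
          have e1 : (run L β γ₁ γ₂ αmax α₁ (0 + 1)).iterate = newtonUpdate L α₁ 0 := by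
            simp [run]
          have e2 : (run L β γ₁ γ₂ αmax α₁ (0 + 1)).time = α₁ := by simp [run]
          rw [e2] at hk2
          rw [e1]
          exact hfirst1.1.norm_scaledGrad_le_first hα₁ hα₁10 hfirst1.2 hk1 hk2
        | succ k =>
          obtain ⟨h, hbd, he, hxx⟩ := hstep k
          exact (htr k).1.norm_scaledGrad_le hA0 (htr (k + 1)).1 hbd he hxx hk1 hk2
      have h1 := hL.objective_sub_le htop (hmem k) hy hboth.1
      have h2 := hL.objective_sub_le htop (hmem (k + 1)) hy hboth.2
      have h3 := (hL.convexOn_objective t).2 (hmem k) (hmem (k + 1)) ha ha' haa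
      simp only [smul_eq_mul] at h3
      have h4 := mul_le_mul_of_nonneg_left h1 ha
      have h5 := mul_le_mul_of_nonneg_left h2 ha'
      have h6 : 0 ≤ W * ε := by positivity
      have h7 : a' = 1 - a := by linarith
      rw [h7] at h3 h5 ⊢
      linarith
    · rw [heq]
      refine ⟨hmem N, fun y hy => ?_⟩
      obtain ⟨hN1, hterm⟩ := hN.1
      obtain ⟨k, rfl⟩ : ∃ k, N = k + 1 := ⟨N - 1, by omega⟩
      -- Since t_N ≤ t ≤ tmax, the time test did not fire, so the norm test did.
      have hterm2 := hterm.resolve_left (not_lt.2 (hNt.trans ht))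
      obtain ⟨hT, -, -, -, hαt⟩ := htr k
      rw [← mul_pow, ← hA] at hterm2
      have h1 := hT.objective_sub_le_of_terminates hL hϑ.1 hϑ.2.1 hb0 (hb _ _ _ hT) hs1
        (by linarith [Real.exp_le_exp.2 hαt]) hA hterm2 hNt ht hy
      have h2 : W * A ^ 2 ≤ W * ε := by gcongr
      linarith
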